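/- Work in Bounded Set Theory $\mathrm{BST}$, i.e. in an arbitrary model of the theory in the language $\{\in,\mathrm{st}\}$ whose axioms are $\mathrm{ZFC}$ (Separation and Replacement for $\in$-formulas), Boundedness ($\forall x\,\exists^{\mathrm{st}}y\; x\in y$), Transfer, Standardization and Bounded Idealization. Let $\mathbb{R}$ be the standard complete ordered field and $\mathbb{N}\subseteq\mathbb{R}$ the set of natural numbers. A real $x$ is *limited* if $|x|<n$ for some standard $n\in\mathbb{N}$; $x\simeq y$ means $|x-y|<1/n$ for all standard $n\in\mathbb{N}\setminus\{0\}$; the *shadow* $\mathrm{sh}(x)$ of a limited $x$ is the unique standard $r\in\mathbb{R}$ with $r\simeq x$. For a formula $\varphi$ of the $\{\in,\mathrm{st}\}$-language (parameters allowed) and a standard set $A$, ${}^{\mathrm{st}}\{x\in A\mid\varphi(x)\}$ denotes the standard set whose standard elements are exactly the standard $x\in A$ with $\varphi(x)$. Let $(M,d)$ be a standard metric space, $I$ a standard set and $w\in I$. A point $x\in M$ is *finite* if $d(x,p)$ is limited for some standard $p\in M$. Put $$B_w={}^{\mathrm{st}}\{f\in M^{I}\mid f(w)\text{ is a finite point of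 }M\},\qquad E_w={}^{\mathrm{st}}\{\langle f,g\rangle\in B_w\times B_w\mid d(f(w),g(w))\simeq 0\},$$ let $D_w:B_w\times B_w\to\mathbb{R}$ be the standard function with $D_w(f,g)=\mathrm{sh}(d(f(w),g(w)))$ for all standard $f,g\in B_w$, let $\widehat M_w=B_w/E_w$, and let $\widehat D_w(f_{E_w},g_{E_w})=D_w(f,g)$ for all $f,g\in B_w$, where $f_{E_w}$ is the class of $f$ modulo $E_w$. The pair $(\widehat M_w,\widehat D_w)$ is the *nonstandard hull* of $(M,d)$ determined by $w$. Call $w\in I$ *good* if there are a standard function $h$ with domain $I$ and a nonstandard $\nu\in\mathbb{N}$ such that $h(w)=\nu$. **Theorem.** (1) If $I=\mathbb{N}$ and $w\in\mathbb{N}$ is unlimited, then these objects exist, $E_w$ is an equivalence relation on $B_w$, $\widehat M_w$ and $\widehat D_w$ are standard, and $(\widehat M_w,\widehat D_w)$ is a complete metric space. (2) The same holds for every infinite standard set $I$ and every good $w\in I$. -/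

import Mathlib

universe u

namespace BST

/-- A structure for the `st`-`∈`-language: a universe of (internal) sets with a membership relation
and a predicate `st x`, "`x` is standard". -/
class StMem (V : Type u) where
  mem : V → V → Prop
  st : V → Prop

/-- Being a standard set. -/
def st {V : Type u} [StMem V] (x : V) : Prop := StMem.st x

/-- From here on `x ∈ y`, for `x y : V`, is the membership relation of the universe `V`. -/
instance {V : Type u} [StMem V] : Membership V V := ⟨fun y x => StMem.mem x y⟩

/-! ### The two first-order languages -/

/-- The relation symbols of the `∈`-language. -/
inductive MemRel : ℕ → Type
  | mem : MemRel 2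

/-- The relation symbols of the `st`-`∈`-language. -/
inductive StMemRel : ℕ → Type
  | mem : StMemRel 2
  | st : StMemRel 1

/-- The `∈`-language. -/
def memLang : FirstOrder.Language := ⟨fun _ => Empty, MemRel⟩

/-- The `st`-`∈`-language. -/
def stMemLang : FirstOrder.Language := ⟨fun _ => Empty, StMemRel⟩

instance {V : Type u} [StMem V] : memLang.Structure V where
  funMap := fun f => Empty.elim f
  RelMap := fun {_} r => match r with
    | MemRel.mem => fun v => v 0 ∈ v 1

instance {V : Type u} [StMem V] : stMemLang.Structure V where
  funMap := fun f => Empty.elim f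
  RelMap := fun {_} r => match r with
    | StMemRel.mem => fun v => v 0 ∈ v 1
    | StMemRel.st => fun v => st (v 0)

/-! ### Set-theoretic vocabulary, evaluated in the universe `V` -/

section Sets

variable {V : Type u} [StMem V]

def IsSubset (a b : V) : Prop := ∀ x : V, x ∈ a → x ∈ b

def IsEmptySet (a : V) : Prop := ∀ x, ¬ x ∈ a

/-- `b = a ∪ {a}`. -/
def IsSucc (b a : V) : Prop := ∀ x, x ∈ b ↔ x ∈ a ∨ x = a

/-- `a` contains `∅` and is closed under `x ↦ x ∪ {x}`. -/
def IsInductive (a : V) : Prop :=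
  (∀ e, IsEmptySet e → e ∈ a) ∧ ∀ x, x ∈ a → ∀ y, IsSucc y x → y ∈ a

/-- `p = {x, y}`. -/
def IsUPair (p x y : V) : Prop := ∀ z, z ∈ p ↔ z = x ∨ z = y

/-- `p` is the (Kuratowski) ordered pair `⟨x, y⟩ = {{x}, {x, y}}`. -/
def IsPair (p x y : V) : Prop := ∀ q, q ∈ p ↔ IsUPair q x x ∨ IsUPair q x y

/-- `⟨x, y⟩ ∈ f`; for a function `f` this says `f(x) = y`. -/
def App (f x y : V) : Prop := ∃ p, p ∈ f ∧ IsPair p x y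

/-- `f` is a function with domain `I`. -/
def IsFunOn (f I : V) : Prop :=
  (∀ p : V, p ∈ f → ∃ x y : V, x ∈ I ∧ IsPair p x y) ∧ ∀ x : V, x ∈ I → ∃! y, App f x y

/-- `f` is a function from `I` to `A`, that is, `f ∈ A^I`. -/
def IsFun (f I A : V) : Prop := IsFunOn f I ∧ ∀ x y, App f x y → y ∈ A

/-- `n` is a von Neumann natural number. -/
def IsVNNat (n : V) : Prop := ∀ a : V, IsInductive a → n ∈ a

/-- `a` is finite (in the sense of the universe `V`): some function is a bijection of a
von Neumann natural number onto `a`. -/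
def IsFin (a : V) : Prop :=
  ∃ n f, IsVNNat n ∧ IsFun f n a ∧ ∀ y, y ∈ a → ∃! x, App f x y

end Sets

/-! ### The axioms -/

/-- The axioms of `ZFC` in `V`. In the two schemata the formula is an `∈`-formula with arbitrary
parameters; `st` is not allowed in it. -/
structure ModelsZFC (V : Type u) [StMem V] : Prop where
  extensionality : ∀ a b : V, (∀ x, x ∈ a ↔ x ∈ b) → a = b
  foundation : ∀ a : V, (∃ x, x ∈ a) → ∃ x, x ∈ a ∧ ∀ y, y ∈ a → ¬ y ∈ x
  pairing : ∀ x y : V, ∃ p, IsUPair p x y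
  union : ∀ a : V, ∃ u : V, ∀ x, x ∈ u ↔ ∃ y, y ∈ a ∧ x ∈ y
  powerset : ∀ a : V, ∃ p : V, ∀ x, x ∈ p ↔ IsSubset x a
  infinity : ∃ a : V, (∃ e, IsEmptySet e ∧ e ∈ a) ∧
    ∀ x, x ∈ a → ∃ y, IsSucc y x ∧ y ∈ a
  separation : ∀ φ : Set V, (Set.univ : Set V).Definable₁ memLang φ →
    ∀ a : V, ∃ b : V, ∀ x, x ∈ b ↔ x ∈ a ∧ x ∈ φ
  replacement : ∀ φ : V → V → Prop,
    (Set.univ : Set V).Definable₂ memLang {q : V × V | φ q.1 q.2} →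
    ∀ a : V, (∀ x, x ∈ a → ∃! y, φ x y) → ∃ b : V, ∀ y, y ∈ b ↔ ∃ x, x ∈ a ∧ φ x y
  choice : ∀ a : V, (∀ x, x ∈ a → ∃ y, y ∈ x) →
    (∀ x y : V, x ∈ a → y ∈ a → (∃ z, z ∈ x ∧ z ∈ y) → x = y) →
    ∃ c : V, ∀ x, x ∈ a → ∃! y, y ∈ x ∧ y ∈ c

/-- `V` is a model of Bounded Set Theory. A class defined by a formula with parameters from a class
`P` is a subset of `V` that is `P.Definable₁` in the language of the formula. -/
structure ModelsBST (V : Type u) [StMem V] : Prop extends ModelsZFC V where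
  boundedness : ∀ x : V, ∃ y : V, st y ∧ x ∈ y
  transfer : ∀ φ : Set V, {p : V | st p}.Definable₁ memLang φ →
    (∀ x, st x → x ∈ φ) → ∀ x, x ∈ φ
  standardization : ∀ φ : Set V, (Set.univ : Set V).Definable₁ stMemLang φ →
    ∀ A : V, ∃ S : V, st S ∧ ∀ x : V, st x → (x ∈ S ↔ x ∈ A ∧ x ∈ φ)
  idealization : ∀ φ : V → V → Prop,
    (Set.univ : Set V).Definable₂ memLang {q : V × V | φ q.1 q.2} →
    ∀ A : V, st A →
      ((∀ a : V, st a → IsFin a → IsSubset a A → ∃ y : V, ∀ x : V, x ∈ a → φ x y) ↔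
        ∃ y : V, ∀ x : V, st x → x ∈ A → φ x y)

/-! ### Sets of the universe as types -/

section Hull

variable {V : Type u} [StMem V]

/-- The elements of the set `A`. -/
abbrev El (A : V) : Type u := {x : V // x ∈ A}

/-- The relation `r ⊆ A × B` is (the extension of) a standard set of the universe. -/
def StandardRel {A B : V} (r : El A → El B → Prop) : Prop :=
  ∃ g : V, st g ∧ ∀ z, z ∈ g ↔ ∃ a b, r a b ∧ IsPair z a.1 b.1

/-- The graph of `F : A × B → C` is (the extension of) a standard set of the universe. -/
def StandardFun₂ {A B C : V} (F : El A → El B → El C) : Prop :=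
  ∃ g : V, st g ∧ ∀ z, z ∈ g ↔ ∃ a b p, IsPair p a.1 b.1 ∧ IsPair z p (F a b).1

/-! ### The real numbers and the natural numbers of the universe -/

/-- `R`, with its operations and order, is the standard complete ordered field of the universe:
it is an ordered field, its carrier, operations and order are standard sets, and every set of the
universe that is a non-empty bounded subset of `R` has a supremum. -/
structure IsReals (R : V) [Field (El R)] [LinearOrder (El R)] [IsStrictOrderedRing (El R)] :
    Prop where
  st_carrier : st R
  st_add : StandardFun₂ (fun x y : El R => x + y)
  st_mul : StandardFun₂ (fun x y : El R => x * y)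
  st_le : StandardRel (fun x y : El R => x ≤ y)
  complete : ∀ S : V, IsSubset S R → (∃ x, x ∈ S) → BddAbove {x : El R | x.1 ∈ S} →
    ∃ s, IsLUB {x : El R | x.1 ∈ S} s

variable {R : V} [Field (El R)] [LinearOrder (El R)]

/-- `x` is a natural number, `ℕ` being the least set of the universe that contains `0 ∈ ℝ` and
is closed under `y ↦ y + 1`. -/
def IsNat (x : El R) : Prop :=
  ∀ S : V, (0 : El R).1 ∈ S → (∀ y : El R, y.1 ∈ S → (y + 1).1 ∈ S) → x.1 ∈ S

/-- `N` is the set of natural numbers, as a subset of the set `R` of reals. -/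
def IsNaturals (R : V) [Field (El R)] (N : V) : Prop :=
  ∀ x, x ∈ N ↔ ∃ r : El R, r.1 = x ∧ IsNat r

/-- `|x| < n` for some standard `n ∈ ℕ`. -/
def Limited (x : El R) : Prop := ∃ n : El R, IsNat n ∧ st n.1 ∧ |x| < n

/-- `x ≃ y`: `|x - y| < 1/n` for all standard `n ∈ ℕ ∖ {0}`. -/
def InfClose (x y : El R) : Prop :=
  ∀ n : El R, IsNat n → n ≠ 0 → st n.1 → |x - y| < 1 / n

/-- `r` is the shadow of the limited real `x`. -/
def IsShadow (r x : El R) : Prop := st r.1 ∧ InfClose r x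

/-! ### Metric spaces of the universe -/

/-- `d` is a metric on the set `M`, with values in `R`. -/
structure IsMetric {M : V} (d : El M → El M → El R) : Prop where
  nonneg : ∀ x y, 0 ≤ d x y
  eq_zero_iff : ∀ x y, d x y = 0 ↔ x = y
  symm : ∀ x y, d x y = d y x
  triangle : ∀ x y z, d x z ≤ d x y + d y z

/-- `F : ℕ → M` is a Cauchy sequence for `d`. -/
def IsCauchy {M : V} (d : El M → El M → El R) (F : V) : Prop :=
  ∀ ε : El R, 0 < ε → ∃ k : El R, IsNat k ∧ ∀ m n : El R, IsNat m → IsNat n →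
    k ≤ m → k ≤ n → ∀ x y : El M, App F m.1 x.1 → App F n.1 y.1 → d x y < ε

/-- `F : ℕ → M` converges to `a` for `d`. -/
def ConvergesTo {M : V} (d : El M → El M → El R) (F : V) (a : El M) : Prop :=
  ∀ ε : El R, 0 < ε → ∃ k : El R, IsNat k ∧ ∀ n : El R, IsNat n →
    k ≤ n → ∀ x : El M, App F n.1 x.1 → d x a < ε

/-- `(M, d)` is a complete metric space (of the universe): `d` is a metric on `M` and every Cauchy
sequence `F : ℕ → M` that is a set of the universe converges to a point of `M`. -/
def IsCompleteMetric (N : V) {M : V} (d : El M → El M → El R) : Prop :=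
  IsMetric d ∧ ∀ F : V, IsFun F N M → IsCauchy d F → ∃ a, ConvergesTo d F a

/-- `x ∈ M` is a finite point: `d(x, p)` is limited for some standard `p ∈ M`. -/
def IsFinitePoint {M : V} (d : El M → El M → El R) (x : El M) : Prop :=
  ∃ p : El M, st p.1 ∧ Limited (d x p)

/-! ### The nonstandard hull -/

/-- `x` is `w`-standard, for `w ∈ I`: `x = f(w)` for some standard function `f` with domain `I`. -/
def WStandard (I w x : V) : Prop := ∃ f, st f ∧ IsFunOn f I ∧ App f w x

/-- `w ∈ I` is good: some natural number is `w`-standard but not standard. -/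
def Good (N I w : V) : Prop := ∃ ν, ν ∈ N ∧ WStandard I w ν ∧ ¬ st ν

/-- `c` is the equivalence class of `f` in `B` modulo the relation `E`. -/
def IsClass (B E f c : V) : Prop := ∀ g, g ∈ c ↔ g ∈ B ∧ App E f g

/-- `E ⊆ B × B` is an equivalence relation on `B`. -/
structure IsEquivRel (B E : V) : Prop where
  subset : ∀ z, z ∈ E → ∃ f g, f ∈ B ∧ g ∈ B ∧ IsPair z f g
  refl : ∀ f, f ∈ B → App E f f
  symm : ∀ f g, App E f g → App E g f
  trans : ∀ f g h, App E f g → App E g h → App E f h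

/-- `(Mh, Dh)` is the nonstandard hull of `(M, d)` determined by `w ∈ I`, and `B`, `E`, `D` are
the objects from which it is formed:
* `B` is the standardization of `{f ∈ M^I | f(w) is a finite point of M}`;
* `E` is the standardization of `{⟨f, g⟩ ∈ B × B | d(f(w), g(w)) ≃ 0}`;
* `D` is the standard function on `B × B` with `D(f, g) = sh(d(f(w), g(w)))` for standard `f, g`;
* `Mh = B / E` is the set of the classes modulo `E`, and `Dh(f_E, g_E) = D(f, g)`. -/
structure IsHull (I w : V) {M : V} (d : El M → El M → El R) (B E : V)
    (D : El B → El B → El R) (Mh : V) (Dh : El Mh → El Mh → El R) : Prop where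
  st_B : st B
  mem_B : ∀ f, st f →
    (f ∈ B ↔ IsFun f I M ∧ ∃ x : El M, App f w x.1 ∧ IsFinitePoint d x)
  st_E : st E
  mem_E : ∀ z, st z → (z ∈ E ↔ ∃ f g, f ∈ B ∧ g ∈ B ∧ IsPair z f g ∧
    ∃ x y : El M, App f w x.1 ∧ App g w y.1 ∧ InfClose (d x y) 0)
  st_D : StandardFun₂ D
  D_eq : ∀ f g : El B, st f.1 → st g.1 → ∀ x y : El M, App f.1 w x.1 → App g.1 w y.1 →
    IsShadow (D f g) (d x y)
  mem_Mh : ∀ c, c ∈ Mh ↔ ∃ f, f ∈ B ∧ IsClass B E f c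
  Dh_eq : ∀ f g : El B, ∀ a b : El Mh, IsClass B E f.1 a.1 → IsClass B E g.1 b.1 →
    Dh a b = D f g

/-- The nonstandard hull of `(M, d)` determined by `w ∈ I` exists, and it is a standard complete
metric space (formed as the quotient by an equivalence relation). -/
def HullIsComplete (N I w : V) {M : V} (d : El M → El M → El R) : Prop :=
  (∃ (B E : V) (D : El B → El B → El R) (Mh : V) (Dh : El Mh → El Mh → El R),
    IsHull I w d B E D Mh Dh) ∧
  ∀ (B E : V) (D : El B → El B → El R) (Mh : V) (Dh : El Mh → El Mh → El R),
    IsHull I w d B E D Mh Dh →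
      IsEquivRel B E ∧ st Mh ∧ StandardFun₂ Dh ∧ IsCompleteMetric N Dh

end Hull

end BST

/-! Existence. Standardization supplies `B`, `E` and a standard graph for `D`. For standard `f, g`
in `B` the points `f(w), g(w)` are finite, so `d(f(w), g(w))` is limited and has exactly one shadow;
Transfer turns this graph into a function on all of `B × B`. The pseudometric laws, and the fact
that `E` is the relation `D(f, g) = 0`, are `∈`-statements with standard parameters, so they need
checking only at standard functions, where they follow from the laws of `d` because shadows respect
order and sums (`IsHullBase.isPseudoMetricWith`). The quotient of a standard pseudometric is then a
standard metric.

Completeness. By Transfer a standard Cauchy sequence `F` suffices. A standard set of representatives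
lifts it to a standard sequence `G_n` in `B`, and for standard `p, q` the distance of `G_p(w)` and
`G_q(w)` exceeds `D(G_p, G_q)` by at most an infinitesimal. Overspill would extend an approximate
form of this to some nonstandard index `m`, making `G_m(w)` the natural limit point; but the limit
must have the form `f(w)` with `f` standard. This is where goodness enters
(`exists_standard_diagonal`): with `h` standard and `h(w) = ν` nonstandard, put `f(i) = G_m(i)`,
where `m = m(i)` is the largest `m ≤ h(i)` such that `d(G_p(i), G_m(i)) ≤ D(G_p, G_m) + 1/m` for all
`p ≤ m`. At `i = w` every standard `m` qualifies, so `m(w)` is nonstandard, and the Cauchy condition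
brings `f(w)` close to `G_p(w)` for large standard `p`. Hence `f` lies in `B` and its class is the
limit (`IsHullBase.exists_limit`). For `I = ℕ` the identity function shows that an unlimited `w` is
good.

The axiom schemata speak of definable classes, so each use of them needs a definability proof. The
classes `DefPred`, `DefFun` and `DefType` let instance search produce these proofs from the shape of
a formula. -/

set_option autoImplicit false
set_option linter.unusedSectionVars false
set_option synthInstance.maxHeartbeats 400000
set_option synthInstance.maxSize 4000

namespace BST

open FirstOrder

/-! ### Definability of predicates and functions on types of sets -/

section Definability

/-- The elements of `Γ` are coded by finite tuples of elements of `V`. -/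
class Coded (V : Type u) (Γ : Type u) where
  Idx : Type
  fin : Finite Idx
  code : Γ → Idx → V
  inj : Function.Injective code

attribute [instance] Coded.fin

instance Coded.self (V : Type u) : Coded V V where
  Idx := Unit
  fin := inferInstance
  code := fun x _ => x
  inj := fun _ _ h => congrFun h ()

instance Coded.subtype (V : Type u) (q : V → Prop) : Coded V {x : V // q x} where
  Idx := Unit
  fin := inferInstance
  code := fun x _ => x.1
  inj := fun _ _ h => Subtype.ext (congrFun h ())

instance Coded.punit (V : Type u) : Coded V PUnit.{u + 1} where
  Idx := Empty
  fin := inferInstance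
  code := fun _ => Empty.elim
  inj := fun _ _ _ => rfl

instance Coded.prod (V Γ Δ : Type u) [Coded V Γ] [Coded V Δ] : Coded V (Γ × Δ) where
  Idx := Coded.Idx V Γ ⊕ Coded.Idx V Δ
  fin := inferInstance
  code := fun x => Sum.elim (Coded.code x.1) (Coded.code x.2)
  inj := fun _ _ h => Prod.ext (Coded.inj (funext fun i => congrFun h (Sum.inl i)))
    (Coded.inj (funext fun i => congrFun h (Sum.inr i)))

variable {V : Type u}

/-- The predicate `p` on `Γ` is defined by a formula of `L` with parameters from `A`. -/
class DefPred (L : FirstOrder.Language.{0, 0}) [L.Structure V] (A : Set V) {Γ : Type u} [Coded V Γ]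
    (p : Γ → Prop) : Prop where
  out : ∃ S : Set (Coded.Idx V Γ → V), A.Definable L S ∧ ∀ γ, p γ ↔ Coded.code γ ∈ S

/-- The function `t : Γ → Δ` is defined by formulas of `L` with parameters from `A`. -/
class DefFun (L : FirstOrder.Language.{0, 0}) [L.Structure V] (A : Set V) {Γ Δ : Type u} [Coded V Γ]
    [Coded V Δ] (t : Γ → Δ) : Prop where
  out : ∀ b : Coded.Idx V Δ, DefPred L A (fun q : Γ × V => q.2 = Coded.code (t q.1) b)

/-- The set of all codes of elements of `Δ` is definable. -/
class DefType (L : FirstOrder.Language.{0, 0}) [L.Structure V] (A : Set V) (Δ : Type u) [Coded V Δ] :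
    Prop where
  out : ∃ S : Set (Coded.Idx V Δ → V), A.Definable L S ∧ ∀ v, v ∈ S ↔ ∃ δ : Δ, Coded.code δ = v

/-- All the components of (the code of) `c` belong to `A`. -/
class Param (A : Set V) {Δ : Type u} [Coded V Δ] (c : Δ) : Prop where
  out : ∀ b, Coded.code (V := V) c b ∈ A

variable {L : FirstOrder.Language.{0, 0}} [L.Structure V] {A : Set V} {Γ Δ Θ : Type u}
  [Coded V Γ] [Coded V Δ] [Coded V Θ]

theorem DefPred.congr {p q : Γ → Prop} (hp : DefPred L A p) (h : ∀ γ, p γ ↔ q γ) :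
    DefPred L A q := by
  rwa [← funext fun γ => propext (h γ)]

instance DefPred.and {p q : Γ → Prop} [hp : DefPred L A p] [hq : DefPred L A q] :
    DefPred L A (fun γ => p γ ∧ q γ) := by
  obtain ⟨S, hS, hpS⟩ := hp
  obtain ⟨T, hT, hqT⟩ := hq
  exact ⟨S ∩ T, hS.inter hT, fun γ => by rw [hpS, hqT, Set.mem_inter_iff]⟩

instance DefPred.not {p : Γ → Prop} [hp : DefPred L A p] : DefPred L A (fun γ => ¬ p γ) := by
  obtain ⟨S, hS, hpS⟩ := hp
  exact ⟨Sᶜ, hS.compl, fun γ => by rw [hpS, Set.mem_compl_iff]⟩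

instance DefPred.or {p q : Γ → Prop} [DefPred L A p] [DefPred L A q] :
    DefPred L A (fun γ => p γ ∨ q γ) :=
  (inferInstance : DefPred L A (fun γ => ¬ (¬ p γ ∧ ¬ q γ))).congr fun γ => by tauto

instance DefPred.imp {p q : Γ → Prop} [DefPred L A p] [DefPred L A q] :
    DefPred L A (fun γ => p γ → q γ) :=
  (inferInstance : DefPred L A (fun γ => ¬ p γ ∨ q γ)).congr fun γ => by tauto

instance DefPred.iff {p q : Γ → Prop} [DefPred L A p] [DefPred L A q] :
    DefPred L A (fun γ => p γ ↔ q γ) :=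
  (inferInstance : DefPred L A (fun γ => (p γ → q γ) ∧ (q γ → p γ))).congr fun γ => by tauto

instance DefPred.exists {p : Γ → Δ → Prop} [hD : DefType L A Δ]
    [hp : DefPred L A (fun q : Γ × Δ => p q.1 q.2)] : DefPred L A (fun γ => ∃ δ, p γ δ) := by
  obtain ⟨S, hS, hpS⟩ := hp
  obtain ⟨T, hT, hDT⟩ := hD
  refine ⟨_, (hS.inter (hT.preimage_comp Sum.inr)).image_comp Sum.inl, fun γ => ?_⟩
  constructor
  · rintro ⟨δ, h⟩
    exact ⟨_, ⟨(hpS (γ, δ)).1 h, (hDT _).2 ⟨δ, rfl⟩⟩, rfl⟩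
  · rintro ⟨v, ⟨hv, hv'⟩, hγ⟩
    obtain ⟨δ, hδ⟩ := (hDT _).1 hv'
    refine ⟨δ, (hpS (γ, δ)).2 ?_⟩
    convert hv using 1
    ext (i | i)
    · exact (congrFun hγ i).symm
    · exact congrFun hδ i

instance DefPred.forall {p : Γ → Δ → Prop} [DefType L A Δ]
    [DefPred L A (fun q : Γ × Δ => p q.1 q.2)] : DefPred L A (fun γ => ∀ δ, p γ δ) :=
  (inferInstance : DefPred L A (fun γ => ¬ ∃ δ, ¬ p γ δ)).congr fun γ => by simp

/-- The languages have no function symbols, so a term is eliminated through its graph: some code `v`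
satisfies `p` and agrees with `t γ` in each coordinate. This conjunction is a formula because codes
are finite tuples. -/
theorem DefPred.subst {p : Δ → Prop} (hp : DefPred L A p) {t : Γ → Δ} (ht : DefFun L A t) :
    DefPred L A (fun γ => p (t γ)) := by
  obtain ⟨S, hS, hpS⟩ := hp
  choose T hT htT using fun b => (ht.out b).out
  refine ⟨_, ((hS.preimage_comp Sum.inr).inter (Set.definable_iInter_of_finite fun b =>
    (hT b).preimage_comp (Sum.map id fun _ => b))).image_comp Sum.inl, fun γ => ?_⟩
  have key : ∀ v b, (Sum.elim (Coded.code γ) v : Coded.Idx V Γ ⊕ Coded.Idx V Δ → V) ∘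
      Sum.map id (fun _ => b) ∈ T b ↔ v b = Coded.code (t γ) b := fun v b => by
    rw [htT b (γ, v b)]
    refine iff_of_eq (congrArg (· ∈ T b) ?_)
    ext (i | i) <;> rfl
  constructor
  · intro h
    refine ⟨Sum.elim (Coded.code γ) (Coded.code (t γ)), ⟨(hpS _).1 h, ?_⟩, rfl⟩
    exact Set.mem_iInter.2 fun b => (key _ b).2 rfl
  · rintro ⟨v, ⟨hv, hv'⟩, hγ⟩
    have hv2 : v = Sum.elim (Coded.code γ) (v ∘ Sum.inr) := by
      rw [← hγ]; ext (i | i) <;> rfl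
    have hvt : v ∘ Sum.inr = Coded.code (t γ) := by
      ext b
      have := Set.mem_iInter.1 hv' b
      rw [hv2] at this
      exact (key _ b).1 this
    refine (hpS _).2 ?_
    rw [← hvt]
    exact hv

theorem DefPred.eq_coord [hA : DefPred L A (fun q : V × V => q.1 = q.2)] {Γ : Type u} [Coded V Γ]
    (b : Coded.Idx V Γ) : DefPred L A (fun q : Γ × V => q.2 = Coded.code q.1 b) := by
  obtain ⟨S, hS, hpS⟩ := hA
  refine ⟨_, hS.preimage_comp (Sum.elim (fun _ => Sum.inr ()) fun _ => Sum.inl b), fun γ => ?_⟩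
  rw [hpS (γ.2, Coded.code γ.1 b)]
  refine iff_of_eq (congrArg (· ∈ S) ?_)
  ext (i | i) <;> rfl

instance DefPred.eq_base : DefPred L A (fun q : V × V => q.1 = q.2) :=
  ⟨{v | v (Sum.inl ()) = v (Sum.inr ())},
    ⟨FirstOrder.Language.Term.equal (FirstOrder.Language.var (Sum.inl ())) (FirstOrder.Language.var (Sum.inr ())), by
      ext v
      simp [FirstOrder.Language.Formula.Realize, FirstOrder.Language.Term.equal]⟩, fun γ => Iff.rfl⟩

instance DefFun.id : DefFun L A (fun γ : Γ => γ) := ⟨fun b => DefPred.eq_coord b⟩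

theorem DefFun.of_reindex (t : Γ → Δ) (e : Coded.Idx V Δ → Coded.Idx V Γ)
    (h : ∀ γ b, Coded.code (t γ) b = Coded.code (V := V) γ (e b)) : DefFun L A t :=
  ⟨fun b => (DefPred.eq_coord (e b)).congr fun γ => by rw [h]⟩

theorem DefFun.pair {t : Γ → Δ} {s : Γ → Θ} (ht : DefFun L A t) (hs : DefFun L A s) :
    DefFun L A (fun γ => (t γ, s γ)) :=
  ⟨fun b => b.rec ht.out hs.out⟩

theorem DefFun.fst_base : DefFun L A (fun q : Γ × Δ => q.1) :=
  .of_reindex _ Sum.inl fun _ _ => rfl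

theorem DefFun.snd_base : DefFun L A (fun q : Γ × Δ => q.2) :=
  .of_reindex _ Sum.inr fun _ _ => rfl

theorem DefFun.comp {t : Δ → Θ} (ht : DefFun L A t) {s : Γ → Δ} (hs : DefFun L A s) :
    DefFun L A (fun γ => t (s γ)) := by
  refine ⟨fun b => ?_⟩
  -- The graph of the composite has one further variable for the value, which the substitution must
  -- carry along unchanged.
  have h : DefFun L A (fun q : Γ × V => (s q.1, q.2)) := by
    refine ⟨fun c => ?_⟩
    have hr : DefFun L A (fun q : (Γ × V) × V => (q.1.1, q.2)) :=
      .of_reindex _ (Sum.map Sum.inl _root_.id) fun _ c => by cases c <;> rfl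
    cases c with
    | inl c => exact (hs.out c).subst hr
    | inr c => exact DefPred.eq_coord (V := V) (Γ := Γ × V) (Sum.inr c)
  exact (ht.out b).subst h

instance DefFun.fst {t : Γ → Δ × Θ} [ht : DefFun L A t] : DefFun L A (fun γ => (t γ).1) :=
  DefFun.fst_base.comp ht

instance DefFun.snd {t : Γ → Δ × Θ} [ht : DefFun L A t] : DefFun L A (fun γ => (t γ).2) :=
  DefFun.snd_base.comp ht

instance DefFun.val {q : V → Prop} {t : Γ → {x : V // q x}} [ht : DefFun L A t] :
    DefFun L A (fun γ => (t γ).1) :=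
  DefFun.comp (t := Subtype.val) (.of_reindex _ (fun _ => ()) fun _ _ => rfl) ht

/-- A function into a set is definable if it is definable as a function into the universe. -/
theorem DefFun.codRestrict {q : V → Prop} {t : Γ → {x : V // q x}}
    (ht : DefFun L A (fun γ => (t γ).1)) : DefFun L A t :=
  ⟨fun b => ht.out b⟩

theorem DefFun.of_graph {q : V → Prop} {t : Γ → {x : V // q x}}
    (h : DefPred L A (fun r : Γ × V => r.2 = (t r.1).1)) : DefFun L A t := ⟨fun _ => h⟩

instance DefFun.const (c : Δ) [hc : Param A c] : DefFun L A (fun _ : Γ => c) := by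
  refine ⟨fun b => ?_⟩
  refine ⟨⟨{v | v (Sum.inr ()) = Coded.code c b}, ⟨FirstOrder.Language.Term.equal
    (FirstOrder.Language.var (Sum.inr ())) (FirstOrder.Language.Constants.term (L.con
      (⟨Coded.code c b, hc.out b⟩ : A))), ?_⟩, fun γ => Iff.rfl⟩⟩
  ext v
  simp [FirstOrder.Language.Formula.Realize, FirstOrder.Language.Term.equal]

instance DefPred.eq {t s : Γ → Δ} [ht : DefFun L A t] [hs : DefFun L A s] :
    DefPred L A (fun γ => t γ = s γ) := by
  have : DefPred L A (fun q : Δ × Δ => q.1 = q.2) := by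
    have h : ∀ b : Coded.Idx V Δ, DefPred L A
        (fun q : Δ × Δ => Coded.code (V := V) q.1 b = Coded.code q.2 b) := fun b => by
      obtain ⟨S, hS, hpS⟩ := DefPred.eq_base (L := L) (A := A)
      refine ⟨_, hS.preimage_comp (Sum.map (fun _ => b) fun _ => b), fun γ => ?_⟩
      rw [hpS (Coded.code γ.1 b, Coded.code γ.2 b)]
      refine iff_of_eq (congrArg (· ∈ S) ?_)
      ext (i | i) <;> rfl
    choose S hS hpS using fun b => (h b).out
    refine ⟨_, Set.definable_iInter_of_finite hS, fun γ => ?_⟩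
    rw [Set.mem_iInter, ← Coded.inj (V := V).eq_iff, funext_iff]
    exact forall_congr' fun b => hpS b γ
  exact this.subst (ht.pair hs)

instance DefPred.ne {t s : Γ → Δ} [DefFun L A t] [DefFun L A s] :
    DefPred L A (fun γ => t γ ≠ s γ) :=
  (inferInstance : DefPred L A (fun γ => ¬ t γ = s γ))

instance DefPred.existsUnique {p : Γ → Δ → Prop} [DefType L A Δ]
    [hp : DefPred L A (fun q : Γ × Δ => p q.1 q.2)] : DefPred L A (fun γ => ∃! δ, p γ δ) := by
  have : DefPred L A (fun q : (Γ × Δ) × Δ => p q.1.1 q.2) :=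
    hp.subst (t := fun q : (Γ × Δ) × Δ => (q.1.1, q.2))
      ((inferInstance : DefFun L A fun q : (Γ × Δ) × Δ => q.1.1).pair inferInstance)
  exact (inferInstance : DefPred L A (fun γ => ∃ δ, p γ δ ∧ ∀ δ', p γ δ' → δ' = δ))

theorem DefPred.comp₂ {r : Δ → Θ → Prop} (hr : DefPred L A (fun q : Δ × Θ => r q.1 q.2))
    {t : Γ → Δ} {s : Γ → Θ} [ht : DefFun L A t] [hs : DefFun L A s] :
    DefPred L A (fun γ => r (t γ) (s γ)) :=
  hr.subst (ht.pair hs)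

theorem DefPred.comp₃ {Ξ : Type u} [Coded V Ξ] {r : Δ → Θ → Ξ → Prop}
    (hr : DefPred L A (fun q : (Δ × Θ) × Ξ => r q.1.1 q.1.2 q.2))
    {t : Γ → Δ} {s : Γ → Θ} {k : Γ → Ξ} [ht : DefFun L A t] [hs : DefFun L A s]
    [hk : DefFun L A k] : DefPred L A (fun γ => r (t γ) (s γ) (k γ)) :=
  hr.subst ((ht.pair hs).pair hk)

theorem DefFun.comp₂ {Ξ : Type u} [Coded V Ξ] {F : Δ → Θ → Ξ}
    (hF : DefFun L A (fun q : Δ × Θ => F q.1 q.2))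
    {t : Γ → Δ} {s : Γ → Θ} [ht : DefFun L A t] [hs : DefFun L A s] :
    DefFun L A (fun γ => F (t γ) (s γ)) :=
  hF.comp (ht.pair hs)

/-- `PUnit` has the empty code and plays the empty context. One-variable statements are phrased over
`PUnit × Δ`, so that their variable is a projection of a tuple like any other. -/
theorem DefPred.unpad {p : Δ → Prop} (hp : DefPred L A (fun q : PUnit.{u + 1} × Δ => p q.2)) :
    DefPred L A p :=
  hp.subst (t := fun γ => (PUnit.unit, γ)) (DefFun.pair (.of_reindex _ Empty.elim fun _ b => b.elim)
    DefFun.id)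

/-- The set of all standard sets. -/
def stSet (V : Type u) [StMem V] : Set V := {x | st x}

instance Param.univ (c : Δ) : Param (Set.univ : Set V) c := ⟨fun _ => Set.mem_univ _⟩

instance Param.val {q : V → Prop} (c : {x : V // q x}) [h : Param A c.1] : Param A c :=
  ⟨h.out⟩

theorem DefPred.mono {B : Set V} (hAB : A ⊆ B) {p : Γ → Prop} (hp : DefPred L A p) :
    DefPred L B p := by
  obtain ⟨S, hS, h⟩ := hp
  exact ⟨S, hS.mono hAB, h⟩

variable [StMem V]

/-- The language `L` expresses the membership relation of `V`. -/
class MemExpr (L : FirstOrder.Language.{0, 0}) (V : Type u) [StMem V] [L.Structure V] : Prop where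
  out : ∃ r : L.Relations 2, ∀ v : Fin 2 → V, FirstOrder.Language.Structure.RelMap r v ↔ v 0 ∈ v 1

instance : MemExpr memLang V := ⟨MemRel.mem, fun _ => Iff.rfl⟩

instance : MemExpr stMemLang V := ⟨StMemRel.mem, fun _ => Iff.rfl⟩

instance DefPred.mem [hL : MemExpr L V] {t s : Γ → V} [DefFun L A t] [DefFun L A s] :
    DefPred L A (fun γ => t γ ∈ s γ) := by
  obtain ⟨r, hr⟩ := hL
  refine DefPred.comp₂ (r := fun x y : V => x ∈ y) ?_
  refine ⟨{v | v (Sum.inl ()) ∈ v (Sum.inr ())}, Set.Definable.mono ?_ (Set.empty_subset A), fun γ => Iff.rfl⟩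
  refine Set.empty_definable_iff.2 ⟨r.formula₂ (FirstOrder.Language.var (Sum.inl ()))
    (FirstOrder.Language.var (Sum.inr ())), ?_⟩
  ext v
  simp [FirstOrder.Language.Formula.realize_rel₂, hr]

instance DefPred.isStandard {t : Γ → V} [ht : DefFun stMemLang A t] :
    DefPred stMemLang A (fun γ => BST.st (t γ)) := by
  refine DefPred.subst (p := fun x : V => BST.st x) ?_ ht
  refine ⟨{v | BST.st (v ())}, Set.Definable.mono ?_ (Set.empty_subset A), fun γ => Iff.rfl⟩
  refine Set.empty_definable_iff.2 ⟨FirstOrder.Language.Relations.formula₁ (L := stMemLang) StMemRel.st (FirstOrder.Language.var ()), ?_⟩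
  ext v
  simp only [Set.mem_ofPred_eq]
  exact Iff.rfl

instance DefType.universe : DefType L A V :=
  ⟨Set.univ, Set.definable_univ, fun v => ⟨fun _ => ⟨v (), rfl⟩, fun _ => trivial⟩⟩

instance DefType.el [MemExpr L V] (B : V) [Param A B] : DefType L A (El B) := by
  have hp : DefPred L A (fun x : V => x ∈ B) := by
    have : DefPred L A (fun x : PUnit.{u+1} × V => x.2 ∈ B) := inferInstance
    exact this.unpad
  obtain ⟨S, hS, h⟩ := hp
  refine ⟨S, hS, fun v => ⟨fun hv => ⟨⟨v (), (h (v ())).2 hv⟩, rfl⟩, ?_⟩⟩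
  rintro ⟨δ, rfl⟩
  exact (h δ.1).1 δ.2

end Definability

/-! ### Definability of the set-theoretic vocabulary -/

section Vocabulary

variable {V : Type u} [StMem V] {L : FirstOrder.Language.{0, 0}} [L.Structure V] [MemExpr L V] {A : Set V}
  {Γ : Type u} [Coded V Γ] {a b c : Γ → V} [DefFun L A a] [DefFun L A b] [DefFun L A c]

instance : DefPred L A (fun γ => IsSubset (a γ) (b γ)) :=
  .comp₂ (by unfold IsSubset; infer_instance)

instance : DefPred L A (fun γ => IsUPair (a γ) (b γ) (c γ)) :=
  .comp₃ (by unfold IsUPair; infer_instance)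

instance : DefPred L A (fun γ => IsPair (a γ) (b γ) (c γ)) :=
  .comp₃ (by unfold IsPair; infer_instance)

instance : DefPred L A (fun γ => App (a γ) (b γ) (c γ)) :=
  .comp₃ (by unfold App; infer_instance)

instance : DefPred L A (fun γ => IsFunOn (a γ) (b γ)) :=
  .comp₂ (by unfold IsFunOn; infer_instance)

instance : DefPred L A (fun γ => IsFun (a γ) (b γ) (c γ)) :=
  .comp₃ (by unfold IsFun; infer_instance)

end Vocabulary

/-! ### The axioms for typed definable predicates -/

section Axioms

variable {V : Type u} {A : Set V}

theorem DefPred.definable₁ {L : FirstOrder.Language.{0, 0}} [L.Structure V] {p : V → Prop}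
    (hp : DefPred L A (fun q : PUnit.{u + 1} × V => p q.2)) : A.Definable₁ L {x | p x} := by
  obtain ⟨S, hS, h⟩ := hp.unpad
  refine (congrArg (A.Definable L) ?_).mp (hS.preimage_comp fun _ => (0 : Fin 1))
  ext v
  exact (h (v 0)).symm

variable [StMem V]

/-- Transfer holds for definable predicates on `Γ`. -/
class TransferType (V : Type u) [StMem V] (Γ : Type u) [Coded V Γ] : Prop where
  transfer : ∀ p : Γ → Prop, DefPred memLang (stSet V) p →
    (∀ γ, Param (stSet V) γ → p γ) → ∀ γ, p γ

theorem param_stSet {x : V} : Param (stSet V) x ↔ st x := ⟨fun h => h.out (), fun h => ⟨fun _ => h⟩⟩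

theorem param_stSet_el {B : V} {x : El B} : Param (stSet V) x ↔ st x.1 :=
  ⟨fun h => h.out (), fun h => ⟨fun _ => h⟩⟩

/-- All standard sets may serve as parameters. -/
class HasSt (A : Set V) : Prop where
  subset : stSet V ⊆ A

instance : HasSt (stSet V) := ⟨subset_rfl⟩

instance : HasSt (Set.univ : Set V) := ⟨Set.subset_univ _⟩

theorem Param.mono {Γ : Type u} [Coded V Γ] [hA : HasSt A] {c : Γ}
    (hc : Param (stSet V) c) : Param A c := ⟨fun b => hA.subset (hc.out b)⟩

/-- Transfer one variable at a time: once the first is standard, it is a legitimate parameter for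
Transfer in the second. -/
instance TransferType.prod (Γ Δ : Type u) [Coded V Γ] [Coded V Δ]
    [DefType memLang (stSet V) Δ] [TransferType V Γ] [TransferType V Δ] : TransferType V (Γ × Δ) where
  transfer p hp h := by
    have h1 : ∀ γ, ∀ δ, p (γ, δ) := by
      refine TransferType.transfer (V := V) _ ?_ fun γ hγ => TransferType.transfer (V := V) _ ?_ fun δ hδ =>
        h (γ, δ) ⟨fun b => ?_⟩
      · have : DefPred memLang (stSet V) (fun q : Γ × Δ => p (q.1, q.2)) := hp
        infer_instance
      · exact hp.subst ((DefFun.const γ).pair DefFun.id)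
      · cases b
        · exact hγ.out _
        · exact hδ.out _
    exact fun γ => h1 γ.1 γ.2

variable {Γ Δ Θ : Type u} [Coded V Γ] [Coded V Δ] [Coded V Θ] [TransferType V Γ]
  [TransferType V Δ] [TransferType V Θ]

theorem transfer {p : Γ → Prop}
    [hp : DefPred memLang (stSet V) (fun q : PUnit.{u + 1} × Γ => p q.2)]
    (h : ∀ γ, Param (stSet V) γ → p γ) : ∀ γ, p γ :=
  TransferType.transfer p hp.unpad h

theorem transfer₂ [DefType memLang (stSet V) Δ] {p : Γ → Δ → Prop}
    [hp : DefPred memLang (stSet V) (fun q : Γ × Δ => p q.1 q.2)]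
    (h : ∀ γ δ, Param (stSet V) γ → Param (stSet V) δ → p γ δ) : ∀ γ δ, p γ δ := fun γ δ =>
  TransferType.transfer _ hp (fun q hq => h q.1 q.2 ⟨fun b => hq.out (Sum.inl b)⟩
    ⟨fun b => hq.out (Sum.inr b)⟩) (γ, δ)

theorem transfer₃ [DefType memLang (stSet V) Δ] [DefType memLang (stSet V) Θ]
    {p : Γ → Δ → Θ → Prop}
    [hp : DefPred memLang (stSet V) (fun q : (Γ × Δ) × Θ => p q.1.1 q.1.2 q.2)]
    (h : ∀ γ δ θ, Param (stSet V) γ → Param (stSet V) δ → Param (stSet V) θ → p γ δ θ) :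
    ∀ γ δ θ, p γ δ θ := fun γ δ θ =>
  TransferType.transfer _ hp (fun q hq => h q.1.1 q.1.2 q.2
    ⟨fun b => hq.out (Sum.inl (Sum.inl b))⟩ ⟨fun b => hq.out (Sum.inl (Sum.inr b))⟩
    ⟨fun b => hq.out (Sum.inr b)⟩) ((γ, δ), θ)

theorem transfer_exists {p : Γ → Prop}
    [DefPred memLang (stSet V) (fun q : PUnit.{u + 1} × Γ => p q.2)] (h : ∃ γ, p γ) :
    ∃ γ, Param (stSet V) γ ∧ p γ := by
  by_contra hn
  push Not at hn
  obtain ⟨γ, hγ⟩ := h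
  exact transfer (p := fun γ => ¬ p γ) hn γ hγ

/-- Transfer provides a standard witness, and uniqueness identifies it with `c`. This is the usual
source of standardness below. -/
theorem param_of_unique (p : Γ → Prop)
    [DefPred memLang (stSet V) (fun q : PUnit.{u + 1} × Γ => p q.2)] {c : Γ} (hc : p c)
    (huniq : ∀ γ, p γ → γ = c) : Param (stSet V) c := by
  obtain ⟨γ, hγ, hγp⟩ := transfer_exists (V := V) ⟨c, hc⟩
  rwa [← huniq γ hγp]

instance Param.ofFact [HasSt A] (c : V) [h : Fact (st c)] : Param A c :=
  Param.mono (param_stSet.2 h.out)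

variable [hV : Fact (ModelsBST V)]

instance TransferType.universe : TransferType V V where
  transfer p hp h := by
    have hp' : DefPred memLang (stSet V) (fun q : PUnit.{u + 1} × V => p q.2) :=
      hp.subst inferInstance
    exact hV.out.transfer _ hp'.definable₁ fun x hx => h x (param_stSet.2 hx)

instance TransferType.el (B : V) [hB : Param (stSet V) B] : TransferType V (El B) where
  transfer p hp h := by
    have hp' : DefPred memLang (stSet V) (fun x : V => ∀ y : El B, y.1 = x → p y) := by
      have : DefPred memLang (stSet V) (fun x : V × El B => p x.2) := hp.subst inferInstance
      have : DefPred memLang (stSet V)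
        (fun x : PUnit.{u+1} × V => ∀ y : El B, y.1 = x.2 → p y) := by
          have : DefPred memLang (stSet V)
            (fun x : (PUnit.{u+1} × V) × El B => p x.2) := hp.subst inferInstance
          infer_instance
      exact this.unpad
    intro x
    refine TransferType.universe.transfer _ hp' (fun x hx y hy => h y ?_) x.1 x rfl
    exact param_stSet_el.2 (hy ▸ param_stSet.1 hx)

theorem ext {a b : V} (h : ∀ x, x ∈ a ↔ x ∈ b) : a = b := hV.out.extensionality a b h

theorem param_of_mem_iff (p : V → Prop)
    [hp : DefPred memLang (stSet V) (fun q : PUnit.{u + 1} × V => p q.2)] {c : V}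
    (hc : ∀ x, x ∈ c ↔ p x) : Param (stSet V) c := by
  have : DefPred memLang (stSet V) (fun q : (PUnit.{u + 1} × V) × V => p q.2) :=
    DefPred.subst (p := fun x : V => p x) (t := fun q : (PUnit.{u + 1} × V) × V => q.2)
      hp.unpad inferInstance
  exact param_of_unique (fun c => ∀ x, x ∈ c ↔ p x) hc fun γ h => ext fun x => by rw [h, hc]

theorem separation (p : V → Prop)
    [hp : DefPred memLang (Set.univ : Set V) (fun q : PUnit.{u + 1} × V => p q.2)] (a : V) :
    ∃ b : V, ∀ x, x ∈ b ↔ x ∈ a ∧ p x :=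
  hV.out.separation _ hp.definable₁ a

theorem standardization (p : V → Prop)
    [hp : DefPred stMemLang (Set.univ : Set V) (fun q : PUnit.{u + 1} × V => p q.2)] (a : V) :
    ∃ b : V, Param (stSet V) b ∧ ∀ x, st x → (x ∈ b ↔ x ∈ a ∧ p x) := by
  obtain ⟨b, hb, h⟩ := hV.out.standardization _ hp.definable₁ a
  exact ⟨b, param_stSet.2 hb, h⟩

/-- The bound `a` need not be standard: it only makes the class a set, and that set is standard
because Extensionality makes it uniquely definable. -/
theorem exists_standard_set (p : V → Prop)
    [hp : DefPred memLang (stSet V) (fun q : PUnit.{u + 1} × V => p q.2)] {a : V}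
    (ha : ∀ x, p x → x ∈ a) : ∃ b : V, Param (stSet V) b ∧ ∀ x, x ∈ b ↔ p x := by
  have := hp.mono (Set.subset_univ _)
  obtain ⟨b, hb⟩ := separation p a
  have h : ∀ x, x ∈ b ↔ p x := fun x => (hb x).trans ⟨And.right, fun h => ⟨ha x h, h⟩⟩
  exact ⟨b, param_of_mem_iff p h, h⟩

/-! ### Pairs and products -/

theorem exists_isPair (x y : V) : ∃ p, IsPair p x y := by
  obtain ⟨a, ha⟩ := hV.out.pairing x x
  obtain ⟨b, hb⟩ := hV.out.pairing x y
  obtain ⟨p, hp⟩ := hV.out.pairing a b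
  refine ⟨p, fun q => (hp q).trans (or_congr ⟨?_, fun h => ?_⟩ ⟨?_, fun h => ?_⟩)⟩
  · rintro rfl; exact ha
  · exact ext fun z => (h z).trans (ha z).symm
  · rintro rfl; exact hb
  · exact ext fun z => (h z).trans (hb z).symm

theorem IsPair.unique {p q x y : V} (hp : IsPair p x y) (hq : IsPair q x y) : p = q :=
  ext fun z => (hp z).trans (hq z).symm

theorem IsPair.inj {p a b c d : V} (h : IsPair p a b) (h' : IsPair p c d) : a = c ∧ b = d := by
  have key : ∀ q, (IsUPair q a a ∨ IsUPair q a b) ↔ (IsUPair q c c ∨ IsUPair q c d) :=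
    fun q => (h q).symm.trans (h' q)
  obtain ⟨aa, haa⟩ := hV.out.pairing a a
  obtain ⟨ab, hab⟩ := hV.out.pairing a b
  obtain ⟨cc, hcc⟩ := hV.out.pairing c c
  obtain ⟨cd, hcd⟩ := hV.out.pairing c d
  have k1 := (key aa).1 (Or.inl haa)
  have k2 := (key ab).1 (Or.inr hab)
  have k3 := (key cc).2 (Or.inl hcc)
  have k4 := (key cd).2 (Or.inr hcd)
  obtain rfl : a = c := by
    rcases k1 with h | h <;> have := (haa c).1 ((h c).2 (Or.inl rfl)) <;> tauto
  refine ⟨rfl, ?_⟩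
  have e1 : b = a ∨ b = d := by
    rcases k2 with h | h <;> have := (h b).1 ((hab b).2 (Or.inr rfl)) <;> tauto
  have e2 : d = a ∨ d = b := by
    rcases k4 with h | h <;> have := (h d).1 ((hcd d).2 (Or.inr rfl)) <;> tauto
  grind

theorem exists_prod (a b : V) : ∃ P : V, ∀ z, z ∈ P ↔ ∃ x ∈ a, ∃ y ∈ b, IsPair z x y := by
  obtain ⟨s, hs⟩ := hV.out.pairing a b
  obtain ⟨u, hu⟩ := hV.out.union s
  obtain ⟨p, hp⟩ := hV.out.powerset u
  obtain ⟨pp, hpp⟩ := hV.out.powerset p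
  have hau : ∀ x, x ∈ a → x ∈ u := fun x hx => (hu x).2 ⟨a, (hs a).2 (Or.inl rfl), hx⟩
  have hbu : ∀ x, x ∈ b → x ∈ u := fun x hx => (hu x).2 ⟨b, (hs b).2 (Or.inr rfl), hx⟩
  obtain ⟨P, hP⟩ := separation (fun z => ∃ x ∈ a, ∃ y ∈ b, IsPair z x y) pp
  refine ⟨P, fun z => (hP z).trans ⟨And.right, fun h => ⟨?_, h⟩⟩⟩
  obtain ⟨x, hx, y, hy, hz⟩ := h
  refine (hpp z).2 fun q hq => (hp q).2 fun r hr => ?_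
  rcases (hz q).1 hq with h | h <;> rcases (h r).1 hr with rfl | rfl
  exacts [hau _ hx, hau _ hx, hau _ hx, hbu _ hy]

/-! ### Standard relations and functions as the definable ones -/

theorem standardRel_of_defPred {a b : V} [Param (stSet V) a] [Param (stSet V) b]
    {r : El a → El b → Prop} [DefPred memLang (stSet V) (fun q : El a × El b => r q.1 q.2)] :
    StandardRel r := by
  obtain ⟨P, hP⟩ := exists_prod a b
  have : DefPred memLang (stSet V)
      (fun q : ((PUnit.{u + 1} × V) × El a) × El b => r q.1.2 q.2) := DefPred.comp₂ inferInstance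
  obtain ⟨g, hg, h⟩ := exists_standard_set (fun z => ∃ x y, r x y ∧ IsPair z x.1 y.1) (a := P)
    fun z ⟨x, y, _, hz⟩ => (hP z).2 ⟨x.1, x.2, y.1, y.2, hz⟩
  exact ⟨g, param_stSet.1 hg, h⟩

theorem standardFun₂_of_defFun {a b c : V} [Param (stSet V) a] [Param (stSet V) b]
    {F : El a → El b → El c} [DefFun memLang (stSet V) (fun q : El a × El b => F q.1 q.2)] :
    StandardFun₂ F := by
  obtain ⟨P, hP⟩ := exists_prod a b
  obtain ⟨Q, hQ⟩ := exists_prod P c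
  have : DefFun memLang (stSet V)
      (fun q : (((PUnit.{u + 1} × V) × El a) × El b) × V => F q.1.1.2 q.1.2) :=
    DefFun.comp₂ inferInstance
  obtain ⟨g, hg, h⟩ := exists_standard_set
    (fun z => ∃ x y p, IsPair p x.1 y.1 ∧ IsPair z p (F x y).1) (a := Q)
    fun z ⟨x, y, p, hp, hz⟩ =>
      (hQ z).2 ⟨p, (hP p).2 ⟨x.1, x.2, y.1, y.2, hp⟩, (F x y).1, (F x y).2, hz⟩
  exact ⟨g, param_stSet.1 hg, h⟩

theorem StandardFun₂.defFun {L : FirstOrder.Language.{0, 0}} [L.Structure V] [MemExpr L V]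
    [HasSt A] {a b c : V}
    {F : El a → El b → El c} (hF : StandardFun₂ F) :
    DefFun L A (fun q : El a × El b => F q.1 q.2) := by
  obtain ⟨g, hg, h⟩ := hF
  have : Param A g := Param.mono (param_stSet.2 hg)
  refine .of_graph ((inferInstance : DefPred L A (fun q : (El a × El b) × V =>
    ∃ z p : V, z ∈ g ∧ IsPair p q.1.1.1 q.1.2.1 ∧ IsPair z p q.2)).congr fun q => ?_)
  constructor
  · rintro ⟨z, p, hz, hp, hzp⟩
    obtain ⟨x, y, p', hp', hz'⟩ := (h z).1 hz
    obtain ⟨rfl, hq⟩ := hzp.inj hz'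
    obtain ⟨h1, h2⟩ := hp.inj hp'
    rw [hq, Subtype.ext h1, Subtype.ext h2]
  · intro hq
    obtain ⟨p, hp⟩ := exists_isPair q.1.1.1 q.1.2.1
    obtain ⟨z, hz⟩ := exists_isPair p q.2
    exact ⟨z, p, (h z).2 ⟨_, _, p, hp, hq ▸ hz⟩, hp, hz⟩

theorem StandardRel.defPred {L : FirstOrder.Language.{0, 0}} [L.Structure V] [MemExpr L V]
    [HasSt A] {a b : V} {r : El a → El b → Prop} (hr : StandardRel r) :
    DefPred L A (fun q : El a × El b => r q.1 q.2) := by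
  obtain ⟨g, hg, h⟩ := hr
  have : Param A g := Param.mono (param_stSet.2 hg)
  refine (inferInstance : DefPred L A (fun q : El a × El b =>
    ∃ z : V, z ∈ g ∧ IsPair z q.1.1 q.2.1)).congr fun q => ?_
  constructor
  · rintro ⟨z, hz, hzp⟩
    obtain ⟨x, y, hxy, hz'⟩ := (h z).1 hz
    obtain ⟨h1, h2⟩ := hzp.inj hz'
    rwa [Subtype.ext h1, Subtype.ext h2]
  · intro hq
    obtain ⟨z, hz⟩ := exists_isPair q.1.1 q.2.1
    exact ⟨z, (h z).2 ⟨_, _, hq, hz⟩, hz⟩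

instance {L : FirstOrder.Language.{0, 0}} [L.Structure V] [MemExpr L V] [HasSt A] {a b c : V}
    {F : El a → El b → El c} [hF : Fact (StandardFun₂ F)] {Γ : Type u} [Coded V Γ]
    {t : Γ → El a} {s : Γ → El b} [DefFun L A t] [DefFun L A s] :
    DefFun L A (fun γ => F (t γ) (s γ)) :=
  DefFun.comp₂ hF.out.defFun

instance {L : FirstOrder.Language.{0, 0}} [L.Structure V] [MemExpr L V] [HasSt A] {a b : V}
    {r : El a → El b → Prop} [hr : Fact (StandardRel r)] {Γ : Type u} [Coded V Γ]
    {t : Γ → El a} {s : Γ → El b} [DefFun L A t] [DefFun L A s] :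
    DefPred L A (fun γ => r (t γ) (s γ)) :=
  DefPred.comp₂ hr.out.defPred

end Axioms

/-! ### Arithmetic in the universe -/

section Reals

variable {V : Type u} [StMem V] [hV : Fact (ModelsBST V)]

variable {R : V} [Field (El R)] [LinearOrder (El R)] [IsStrictOrderedRing (El R)]
  [hR : Fact (IsReals R)]

instance : Param (stSet V) R := param_stSet.2 hR.out.st_carrier

instance : Fact (StandardFun₂ (HAdd.hAdd : El R → El R → El R)) := ⟨hR.out.st_add⟩

instance : Fact (StandardFun₂ (HMul.hMul : El R → El R → El R)) := ⟨hR.out.st_mul⟩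

instance : Fact (StandardRel (LE.le : El R → El R → Prop)) := ⟨hR.out.st_le⟩

instance : Fact (StandardRel (LT.lt : El R → El R → Prop)) := by
  refine ⟨?_⟩
  have : DefPred memLang (stSet V) (fun q : El R × El R => q.1 < q.2) :=
    (inferInstance : DefPred memLang (stSet V) (fun q : El R × El R => ¬ q.2 ≤ q.1)).congr
      fun q => not_le
  exact standardRel_of_defPred

instance : Param (stSet V) (0 : El R).1 := by
  refine param_stSet.2 (param_stSet_el.1 (?_ : Param (stSet V) (0 : El R)))
  exact param_of_unique (fun x : El R => x + x = x) (by simp) fun x h => by simpa using h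

instance : Param (stSet V) (1 : El R).1 := by
  refine param_stSet.2 (param_stSet_el.1 (?_ : Param (stSet V) (1 : El R)))
  refine param_of_unique (fun x : El R => x * x = x ∧ x ≠ 0) (by simp) fun x ⟨h, h0⟩ => ?_
  exact mul_right_cancel₀ h0 (by simpa using h)

instance : Fact (StandardFun₂ (HSub.hSub : El R → El R → El R)) := by
  have : DefFun memLang (stSet V) (fun q : El R × El R => q.1 - q.2) := .of_graph <|
    (inferInstance : DefPred memLang (stSet V) (fun q : (El R × El R) × V =>
      ∃ z : El R, z.1 = q.2 ∧ z + q.1.2 = q.1.1)).congr fun q => by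
        simp only [← eq_sub_iff_add_eq, exists_eq_right]; exact eq_comm
  exact ⟨standardFun₂_of_defFun⟩

instance : Fact (StandardFun₂ (HDiv.hDiv : El R → El R → El R)) := by
  have : DefFun memLang (stSet V) (fun q : El R × El R => q.1 / q.2) := .of_graph <| by
    -- The second alternative records the convention `x / 0 = 0`.
    refine (inferInstance : DefPred memLang (stSet V) (fun q : (El R × El R) × V =>
      ∃ z : El R, z.1 = q.2 ∧ ((q.1.2 ≠ 0 ∧ z * q.1.2 = q.1.1) ∨ (q.1.2 = 0 ∧ z = 0)))).congr
        fun q => ?_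
    have : ∀ z : El R, ((q.1.2 ≠ 0 ∧ z * q.1.2 = q.1.1) ∨ (q.1.2 = 0 ∧ z = 0)) ↔
        z = q.1.1 / q.1.2 := fun z => by
      by_cases h : q.1.2 = 0
      · simp [h]
      · simp [h, eq_div_iff]
    simp only [this, exists_eq_right]
    exact eq_comm
  exact ⟨standardFun₂_of_defFun⟩

variable {L : FirstOrder.Language.{0, 0}} [L.Structure V] [MemExpr L V] {A : Set V} [HasSt A]

instance : Param A R := Param.mono inferInstance

instance : Param A (0 : El R).1 := Param.mono inferInstance

instance : Param A (1 : El R).1 := Param.mono inferInstance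

variable {Γ : Type u} [Coded V Γ] {t s : Γ → El R} [DefFun L A t] [DefFun L A s]

instance : DefPred L A (fun γ => IsNat (t γ)) := by
  have : DefPred L A (fun q : PUnit.{u + 1} × El R => IsNat q.2) := by
    unfold IsNat; infer_instance
  exact this.unpad.subst inferInstance

instance {A : Set V} [HasSt A] {t s : Γ → El R} [DefFun stMemLang A t] [DefFun stMemLang A s] :
    DefPred stMemLang A (fun γ => InfClose (t γ) (s γ)) := by
  have : DefPred stMemLang A (fun q : El R × El R => InfClose q.1 q.2) := by
    unfold InfClose
    -- Absolute value and negation are rewritten away, which leaves sums, differences, quotients and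
    -- order, already known to be definable.
    simp only [abs_lt, neg_lt_iff_pos_add]
    infer_instance
  exact this.comp₂

instance {A : Set V} [HasSt A] {t : Γ → El R} [DefFun stMemLang A t] :
    DefPred stMemLang A (fun γ => Limited (t γ)) := by
  have : DefPred stMemLang A (fun q : PUnit.{u + 1} × El R => Limited q.2) := by
    unfold Limited
    simp only [abs_lt, neg_lt_iff_pos_add]
    infer_instance
  exact this.unpad.subst inferInstance

theorem IsNaturals.param {N : V} (hN : IsNaturals R N) : Param (stSet V) N :=
  param_of_mem_iff (fun x => ∃ r : El R, r.1 = x ∧ IsNat r) hN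

end Reals

/-! ### Induction, standard natural numbers and shadows -/

section Naturals

variable {V : Type u} [StMem V] {R : V} [Field (El R)]

theorem isNat_zero : IsNat (0 : El R) := fun _ h _ => h

theorem IsNat.succ {n : El R} (hn : IsNat n) : IsNat (n + 1) :=
  fun S h0 hs => hs n (hn S h0 hs)

variable [hV : Fact (ModelsBST V)]

theorem param_apply₂ {a b c : V} {F : El a → El b → El c} [Fact (StandardFun₂ F)]
    [Param (stSet V) c] {x : El a} {y : El b} (hx : Param (stSet V) x) (hy : Param (stSet V) y) :
    Param (stSet V) (F x y) := by
  have : Fact (st x.1) := ⟨param_stSet_el.1 hx⟩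
  have : Fact (st y.1) := ⟨param_stSet_el.1 hy⟩
  exact param_of_unique (fun z => z = F x y) rfl fun _ h => h

variable [LinearOrder (El R)] [IsStrictOrderedRing (El R)] [hR : Fact (IsReals R)]

instance : Param (stSet V) (2 : El R).1 :=
  param_stSet.2 (param_stSet_el.1 (one_add_one_eq_two (R := El R) ▸
    param_apply₂ (F := HAdd.hAdd) inferInstance inferInstance))

theorem IsNat.induction (p : El R → Prop)
    [hp : DefPred memLang (Set.univ : Set V) (fun q : PUnit.{u + 1} × El R => p q.2)]
    (h0 : p 0) (hs : ∀ n, IsNat n → p n → p (n + 1)) {n : El R} (hn : IsNat n) : p n := by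
  have : DefPred memLang (Set.univ : Set V)
    (fun q : (PUnit.{u + 1} × V) × El R => p q.2) := hp.unpad.subst inferInstance
  obtain ⟨S, hS⟩ := separation (fun x => ∃ r : El R, r.1 = x ∧ IsNat r ∧ p r) R
  have hS' : ∀ r : El R, r.1 ∈ S ↔ IsNat r ∧ p r := fun r => by
    rw [hS]
    constructor
    · rintro ⟨_, r', h, hr⟩
      rwa [← Subtype.ext h]
    · exact fun h => ⟨r.2, r, rfl, h⟩
  exact ((hS' n).1 (hn S ((hS' 0).2 ⟨isNat_zero, h0⟩) fun y hy =>
    (hS' _).2 ⟨((hS' y).1 hy).1.succ, hs y ((hS' y).1 hy).1 ((hS' y).1 hy).2⟩)).2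

/-- Induction over the standard natural numbers, for arbitrary formulas. -/
theorem IsNat.standard_induction (p : El R → Prop)
    [hp : DefPred stMemLang (Set.univ : Set V) (fun q : PUnit.{u + 1} × El R => p q.2)]
    (h0 : p 0) (hs : ∀ n, IsNat n → st n.1 → p n → p (n + 1)) {n : El R} (hn : IsNat n)
    (hst : st n.1) : p n := by
  have : DefPred stMemLang (Set.univ : Set V)
    (fun q : (PUnit.{u + 1} × V) × El R => p q.2) := hp.unpad.subst inferInstance
  obtain ⟨S, hSst, hS⟩ := standardization (fun x => ∃ r : El R, r.1 = x ∧ IsNat r ∧ p r) R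
  have hS' : ∀ r : El R, st r.1 → (r.1 ∈ S ↔ IsNat r ∧ p r) := fun r hr => by
    rw [hS _ hr]
    constructor
    · rintro ⟨_, r', h, hr⟩
      rwa [← Subtype.ext h]
    · exact fun h => ⟨r.2, r, rfl, h⟩
  refine ((hS' n hst).1 (hn S ((hS' 0 (param_stSet.1 inferInstance)).2 ⟨isNat_zero, h0⟩) ?_)).2
  -- Only standard elements of `S` are understood, but `S` is standard, so closure under successor
  -- transfers from them to all reals.
  refine transfer (V := V) (p := fun y : El R => y.1 ∈ S → (y + 1).1 ∈ S) fun y hyst hy => ?_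
  have hy' := (hS' y (param_stSet_el.1 hyst)).1 hy
  refine (hS' _ (param_stSet_el.1 (param_apply₂ hyst inferInstance))).2
    ⟨hy'.1.succ, hs y hy'.1 (param_stSet_el.1 hyst) hy'.2⟩

theorem IsNat.nonneg {n : El R} (hn : IsNat n) : 0 ≤ n :=
  IsNat.induction (fun n : El R => 0 ≤ n) le_rfl (fun n _ h => by linarith) hn

theorem IsNat.eq_zero_or_succ {n : El R} (hn : IsNat n) : n = 0 ∨ ∃ k, IsNat k ∧ n = k + 1 :=
  IsNat.induction (fun n : El R => n = 0 ∨ ∃ k, IsNat k ∧ n = k + 1) (Or.inl rfl)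
    (fun n hn _ => Or.inr ⟨n, hn, rfl⟩) hn

theorem IsNat.succ_le {n m : El R} (hn : IsNat n) (hm : IsNat m) (h : n < m) : n + 1 ≤ m := by
  refine IsNat.induction (fun n : El R => ∀ m : El R, IsNat m → n < m → n + 1 ≤ m) ?_ ?_ hn m hm h
  · intro m hm h
    obtain rfl | ⟨k, hk, rfl⟩ := hm.eq_zero_or_succ
    · exact absurd h (lt_irrefl _)
    · linarith [hk.nonneg]
  · intro n hn ih m hm h
    obtain rfl | ⟨k, hk, rfl⟩ := hm.eq_zero_or_succ
    · linarith [hn.nonneg]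
    · linarith [ih k hk (by linarith)]

/-- The predicate mentions `st`, so external induction is needed. The consequence that a nonstandard
natural exceeds every standard one takes the place of overspill. -/
theorem IsNat.st_of_le {n k : El R} (hn : IsNat n) (hnst : st n.1) (hk : IsNat k) (h : k ≤ n) :
    st k.1 := by
  refine IsNat.standard_induction (fun n : El R => ∀ k : El R, IsNat k → k ≤ n → st k.1)
    ?_ ?_ hn hnst k hk h
  · intro k hk h
    obtain rfl := le_antisymm h hk.nonneg
    exact param_stSet.1 inferInstance
  · intro n hn hnst ih k hk h
    rcases lt_or_ge k (n + 1) with h' | h'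
    · exact ih k hk (by linarith [hk.succ_le hn.succ h'])
    · obtain rfl := le_antisymm h h'
      exact param_stSet_el.1 (param_apply₂ (param_stSet_el.2 hnst) inferInstance)

theorem IsNat.lt_of_not_st {ν n : El R} (hν : IsNat ν) (hνst : ¬ st ν.1) (hn : IsNat n)
    (hnst : st n.1) : n < ν :=
  lt_of_not_ge fun h => hνst (hn.st_of_le hnst hν h)

/-- Internal induction on the bound. The choice of a maximum, rather than of any witness, makes the
diagonal index of the completeness proof definable. -/
theorem IsNat.exists_max (p : El R → Prop)
    [hp : DefPred memLang (Set.univ : Set V) (fun q : PUnit.{u + 1} × El R => p q.2)]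
    (h0 : p 0) {n : El R} (hn : IsNat n) :
    ∃ m, IsNat m ∧ m ≤ n ∧ p m ∧ ∀ k, IsNat k → k ≤ n → p k → k ≤ m := by
  have : DefPred memLang (Set.univ : Set V)
    (fun q : (PUnit.{u + 1} × El R) × El R => p q.2) := hp.unpad.subst inferInstance
  have : DefPred memLang (Set.univ : Set V)
    (fun q : ((PUnit.{u + 1} × El R) × El R) × El R => p q.2) := hp.unpad.subst inferInstance
  refine IsNat.induction (fun n : El R => ∃ m, IsNat m ∧ m ≤ n ∧ p m ∧
    ∀ k, IsNat k → k ≤ n → p k → k ≤ m) ⟨0, isNat_zero, le_rfl, h0, fun _ _ h _ => h⟩ ?_ hn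
  rintro n hn ⟨m, hm, hmn, hpm, hmax⟩
  by_cases hp' : p (n + 1)
  · exact ⟨n + 1, hn.succ, le_rfl, hp', fun _ _ h _ => h⟩
  · refine ⟨m, hm, by linarith, hpm, fun k hk hkn hpk => ?_⟩
    have hne : k ≠ n + 1 := by rintro rfl; exact hp' hpk
    exact hmax k hk (by linarith [hk.succ_le hn.succ (lt_of_le_of_ne hkn hne)]) hpk

theorem exists_isNat_gt (x : El R) : ∃ n : El R, IsNat n ∧ x < n := by
  by_contra! h
  obtain ⟨S, hS⟩ := separation (fun x => ∃ r : El R, r.1 = x ∧ IsNat r) R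
  have hS' : ∀ r : El R, r.1 ∈ S ↔ IsNat r := fun r => by
    rw [hS]
    constructor
    · rintro ⟨_, r', h, hr⟩
      rwa [← Subtype.ext h]
    · exact fun h => ⟨r.2, r, rfl, h⟩
  obtain ⟨s, hs⟩ := hR.out.complete S (fun x hx => ((hS x).1 hx).1) ⟨_, (hS' 0).2 isNat_zero⟩
    ⟨x, fun n hn => h n ((hS' n).1 hn)⟩
  -- Closure under successor makes `s - 1` an upper bound as well.
  have : s ≤ s - 1 := hs.2 fun n hn => by
    have h1 : n + 1 ≤ s := hs.1 ((hS' _).2 ((hS' n).1 hn).succ)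
    linarith
  linarith

theorem exists_st_isNat_gt {x : El R} (hx : st x.1) :
    ∃ n : El R, IsNat n ∧ st n.1 ∧ x < n := by
  have : Fact (st x.1) := ⟨hx⟩
  obtain ⟨n, hn, h⟩ := transfer_exists (V := V) (exists_isNat_gt x)
  exact ⟨n, h.1, param_stSet_el.1 hn, h.2⟩

theorem limited_of_le {x y : El R} (hx : st x.1) (h : |y| ≤ x) : Limited y := by
  obtain ⟨n, hn, hnst, hxn⟩ := exists_st_isNat_gt hx
  exact ⟨n, hn, hnst, h.trans_lt hxn⟩

/-- The bounds `1/n` are cofinal among the standard positive reals by the standard Archimedean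
property; arbitrary standard `e` can then be halved. -/
theorem infClose_iff {x y : El R} :
    InfClose x y ↔ ∀ e : El R, st e.1 → 0 < e → |x - y| < e := by
  constructor
  · intro h e he he0
    obtain ⟨n, hn, hnst, hen⟩ := exists_st_isNat_gt (x := 1 / e)
      (param_stSet_el.1 (param_apply₂ inferInstance (param_stSet_el.2 he)))
    have hn0 : 0 < n := (one_div_pos.2 he0).trans hen
    refine (h n hn hn0.ne' hnst).trans ?_
    rwa [one_div_lt hn0 he0]
  · intro h n hn hn0 hnst
    exact h _ (param_stSet_el.1 (param_apply₂ inferInstance (param_stSet_el.2 hnst)))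
      (one_div_pos.2 (lt_of_le_of_ne hn.nonneg hn0.symm))

theorem le_of_forall_lt_add {x y : El R} (hx : st x.1) (hy : st y.1)
    (h : ∀ e : El R, st e.1 → 0 < e → x < y + e) : x ≤ y := by
  by_contra hlt
  have := h (x - y) (param_stSet_el.1 (param_apply₂ (param_stSet_el.2 hx) (param_stSet_el.2 hy)))
    (sub_pos.2 (not_le.1 hlt))
  linarith

theorem st_half {e : El R} (he : st e.1) : st (e / 2).1 :=
  param_stSet_el.1 (param_apply₂ (param_stSet_el.2 he) inferInstance)

theorem IsShadow.lt_add {r x : El R} (h : IsShadow r x) {e : El R} (he : st e.1) (he0 : 0 < e) :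
    r < x + e := by
  linarith [(abs_lt.1 (infClose_iff.1 h.2 e he he0)).2]

theorem IsShadow.lt_add' {r x : El R} (h : IsShadow r x) {e : El R} (he : st e.1) (he0 : 0 < e) :
    x < r + e := by
  linarith [(abs_lt.1 (infClose_iff.1 h.2 e he he0)).1]

theorem IsShadow.le {r s x y : El R} (hr : IsShadow r x) (hs : IsShadow s y) (h : x ≤ y) :
    r ≤ s := by
  refine le_of_forall_lt_add hr.1 hs.1 fun e he he0 => ?_
  linarith [hr.lt_add (st_half he) (half_pos he0), hs.lt_add' (st_half he) (half_pos he0)]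

theorem IsShadow.unique {r s x : El R} (hr : IsShadow r x) (hs : IsShadow s x) : r = s :=
  le_antisymm (hr.le hs le_rfl) (hs.le hr le_rfl)

theorem IsShadow.self {r : El R} (hr : st r.1) : IsShadow r r :=
  ⟨hr, infClose_iff.2 fun e _ he0 => by simpa using he0⟩

theorem IsShadow.add {r s x y : El R} (hr : IsShadow r x) (hs : IsShadow s y) :
    IsShadow (r + s) (x + y) := by
  refine ⟨param_stSet_el.1 (param_apply₂ (param_stSet_el.2 hr.1) (param_stSet_el.2 hs.1)),
    infClose_iff.2 fun e he he0 => abs_lt.2 ⟨?_, ?_⟩⟩ <;>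
  linarith [hr.lt_add (st_half he) (half_pos he0), hs.lt_add (st_half he) (half_pos he0),
    hr.lt_add' (st_half he) (half_pos he0), hs.lt_add' (st_half he) (half_pos he0)]

theorem IsShadow.eq_zero_iff {r x : El R} (hr : IsShadow r x) : r = 0 ↔ InfClose x 0 := by
  constructor
  · rintro rfl
    exact infClose_iff.2 fun e he he0 => by
      rw [abs_sub_comm]
      exact infClose_iff.1 hr.2 e he he0
  · intro h
    refine hr.unique ⟨param_stSet.1 inferInstance, infClose_iff.2 fun e he he0 => ?_⟩
    rw [abs_sub_comm]
    exact infClose_iff.1 h e he he0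

/-- The shadow is the supremum of the standard set `S` whose standard elements are the standard
reals below or equal to `x`. A standard gap `e` between the two would put `r + e` in `S` or make `r
- e` an upper bound. -/
theorem Limited.exists_shadow {x : El R} (hx : Limited x) : ∃ r, IsShadow r x := by
  obtain ⟨n, hn, hnst, hxn⟩ := hx
  have hxn := abs_lt.1 hxn
  obtain ⟨S, hSst, hS⟩ := standardization (fun z => ∃ r : El R, r.1 = z ∧ r ≤ x) R
  have hS' : ∀ r : El R, st r.1 → (r.1 ∈ S ↔ r ≤ x) := fun r hr => by
    rw [hS _ hr]
    constructor
    · rintro ⟨_, r', h, hr⟩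
      rwa [← Subtype.ext h]
    · exact fun h => ⟨r.2, r, rfl, h⟩
  have : Fact (st n.1) := ⟨hnst⟩
  have hSR : IsSubset S R := transfer (V := V) (p := fun z => z ∈ S → z ∈ R)
    fun z hz hzS => ((hS z (param_stSet.1 hz)).1 hzS).1
  -- `-n` is written as a difference because subtraction is a known standard function; it witnesses
  -- that `S` is nonempty.
  have hneg : st (0 - n).1 := param_stSet_el.1 (param_apply₂ inferInstance inferInstance)
  -- A standard bound of `x` dominates the standard elements of `S`, hence all of them by Transfer.
  have hbound : ∀ b : El R, st b.1 → x ≤ b → ∀ y : El R, y.1 ∈ S → y ≤ b := fun b hb hxb => by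
    have : Fact (st b.1) := ⟨hb⟩
    refine transfer (V := V) (p := fun y : El R => y.1 ∈ S → y ≤ b) fun y hy hyS => ?_
    exact ((hS' y (param_stSet_el.1 hy)).1 hyS).trans hxb
  obtain ⟨r, hr⟩ := hR.out.complete S hSR ⟨_, (hS' (0 - n) hneg).2 (by linarith)⟩
    ⟨n, hbound n hnst hxn.2.le⟩
  have hrst : st r.1 := param_stSet_el.1 <| param_of_unique
    (fun r : El R => (∀ y : El R, y.1 ∈ S → y ≤ r) ∧ ∀ b : El R, (∀ y : El R, y.1 ∈ S → y ≤ b) → r ≤ b)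
    ⟨fun y hy => hr.1 hy, fun b hb => hr.2 fun y hy => hb y hy⟩
    fun s hs => le_antisymm (hs.2 r fun y hy => hr.1 hy) (hr.2 fun y hy => hs.1 y hy)
  refine ⟨r, hrst, infClose_iff.2 fun e he he0 => abs_lt.2 ⟨?_, ?_⟩⟩
  · by_contra h
    have hre : st (r + e).1 :=
      param_stSet_el.1 (param_apply₂ (param_stSet_el.2 hrst) (param_stSet_el.2 he))
    have := hr.1 ((hS' _ hre).2 (by linarith))
    linarith
  · by_contra h
    have hre : st (r - e).1 :=
      param_stSet_el.1 (param_apply₂ (param_stSet_el.2 hrst) (param_stSet_el.2 he))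
    have := hr.2 fun y hy => hbound (r - e) hre (by linarith) y hy
    linarith

end Naturals
set_option linter.unusedSectionVars false

/-! ### The nonstandard hull -/

section Hull

variable {V : Type u} [StMem V]

theorem IsFun.exists_app {f a b : V} (hf : IsFun f a b) {x : V} (hx : x ∈ a) :
    ∃ y : El b, App f x y.1 := by
  obtain ⟨y, hy, _⟩ := hf.1.2 x hx
  exact ⟨⟨y, hf.2 x y hy⟩, hy⟩

theorem IsFun.app_unique {f a b : V} (hf : IsFun f a b) {x y z : V} (hx : x ∈ a) (hy : App f x y)
    (hz : App f x z) : y = z :=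
  (hf.1.2 x hx).unique hy hz

variable [hV : Fact (ModelsBST V)]

theorem IsPair.param {p x y : V} (hp : IsPair p x y) (hx : Param (stSet V) x)
    (hy : Param (stSet V) y) : Param (stSet V) p :=
  param_of_unique (fun p => IsPair p x y) hp fun _ h => h.unique hp

/-- Any set containing all functions from `a` to `b` will do as the bound in Standardization. -/
theorem exists_forall_isFun_mem (a b : V) : ∃ P : V, ∀ f, IsFun f a b → f ∈ P := by
  obtain ⟨Q, hQ⟩ := exists_prod a b
  obtain ⟨P, hP⟩ := hV.out.powerset Q
  refine ⟨P, fun f hf => (hP f).2 fun p hp => (hQ p).2 ?_⟩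
  obtain ⟨x, y, hx, hxy⟩ := hf.1.1 p hp
  exact ⟨x, hx, y, hf.2 x y ⟨p, hp, hxy⟩, hxy⟩

instance {L : FirstOrder.Language.{0, 0}} [L.Structure V] [MemExpr L V] {A : Set V}
    {Γ : Type u} [Coded V Γ] {a b c e : Γ → V} [ha : DefFun L A a] [hb : DefFun L A b]
    [hc : DefFun L A c] [he : DefFun L A e] :
    DefPred L A (fun γ => IsClass (a γ) (b γ) (c γ) (e γ)) := by
  have : DefPred L A (fun q : ((V × V) × V) × V => IsClass q.1.1.1 q.1.1.2 q.1.2 q.2) := by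
    unfold IsClass; infer_instance
  exact this.subst (((ha.pair hb).pair hc).pair he)

variable {R : V} [Field (El R)] [LinearOrder (El R)] [IsStrictOrderedRing (El R)]
  [hR : Fact (IsReals R)]

instance {A : Set V} [HasSt A] {Γ : Type u} [Coded V Γ] {t s : Γ → El R} [DefFun stMemLang A t]
    [DefFun stMemLang A s] : DefPred stMemLang A (fun γ => IsShadow (t γ) (s γ)) := by
  have : DefPred stMemLang A (fun q : El R × El R => IsShadow q.1 q.2) := by
    unfold IsShadow; infer_instance
  exact this.comp₂

variable {M : V} {d : El M → El M → El R}

theorem IsFinitePoint.of_limited_dist (hm : IsMetric d) {x y : El M} (hx : IsFinitePoint d x)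
    (h : Limited (d y x)) : IsFinitePoint d y := by
  obtain ⟨p, hp, n, -, hnst, hn⟩ := hx
  obtain ⟨m, -, hmst, hm'⟩ := h
  refine ⟨p, hp, limited_of_le (x := m + n) (param_stSet_el.1 <| param_apply₂
    (param_stSet_el.2 hmst) (param_stSet_el.2 hnst)) ?_⟩
  rw [abs_of_nonneg (hm.nonneg _ _)]
  linarith [hm.triangle y x p, (abs_lt.1 hn).2, (abs_lt.1 hm').2]

variable [hd : Fact (StandardFun₂ d)]

theorem IsFinitePoint.limited_dist (hm : IsMetric d) {x y : El M} (hx : IsFinitePoint d x)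
    (hy : IsFinitePoint d y) : Limited (d x y) := by
  obtain ⟨p, hp, n, -, hnst, hn⟩ := hx
  obtain ⟨q, hq, m, -, hmst, hm'⟩ := hy
  have h : st (n + d p q + m).1 := param_stSet_el.1 <| param_apply₂ (param_apply₂
    (param_stSet_el.2 hnst) (param_apply₂ (param_stSet_el.2 hp) (param_stSet_el.2 hq)))
    (param_stSet_el.2 hmst)
  refine limited_of_le h ?_
  rw [abs_of_nonneg (hm.nonneg _ _)]
  linarith [hm.triangle x p y, hm.triangle p q y, hm.symm q y, (abs_lt.1 hn).2, (abs_lt.1 hm').2]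

variable {I w : V}

theorem exists_isHull_base (d : El M → El M → El R) [Fact (StandardFun₂ d)] (I w : V) : ∃ B : V, st B ∧ ∀ f, st f →
    (f ∈ B ↔ IsFun f I M ∧ ∃ x : El M, App f w x.1 ∧ IsFinitePoint d x) := by
  obtain ⟨P, hP⟩ := exists_forall_isFun_mem I M
  have : DefPred stMemLang (Set.univ : Set V) (fun q : PUnit.{u + 1} × V =>
      IsFun q.2 I M ∧ ∃ x : El M, App q.2 w x.1 ∧ IsFinitePoint d x) := by
    unfold IsFinitePoint; infer_instance
  obtain ⟨B, hB, h⟩ := standardization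
    (fun f => IsFun f I M ∧ ∃ x : El M, App f w x.1 ∧ IsFinitePoint d x) P
  exact ⟨B, param_stSet.1 hB, fun f hf => (h f hf).trans
    ⟨And.right, fun h => ⟨hP f h.1, h⟩⟩⟩

variable {B : V}

theorem exists_isHull_rel (d : El M → El M → El R) [Fact (StandardFun₂ d)] (w B : V) :
    ∃ E : V, st E ∧ ∀ z, st z → (z ∈ E ↔ ∃ f g, f ∈ B ∧ g ∈ B ∧ IsPair z f g ∧
      ∃ x y : El M, App f w x.1 ∧ App g w y.1 ∧ InfClose (d x y) 0) := by
  obtain ⟨P, hP⟩ := exists_prod B B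
  obtain ⟨E, hE, h⟩ := standardization (fun z => ∃ f g, f ∈ B ∧ g ∈ B ∧ IsPair z f g ∧
      ∃ x y : El M, App f w x.1 ∧ App g w y.1 ∧ InfClose (d x y) 0) P
  refine ⟨E, param_stSet.1 hE, fun z hz => (h z hz).trans ⟨And.right, fun h => ⟨?_, h⟩⟩⟩
  obtain ⟨f, g, hf, hg, hzp, -⟩ := h
  exact (hP z).2 ⟨f, hf, g, hg, hzp⟩

variable [hM : Fact (st M)]

/-- Standardization gives a set `G` whose standard elements are the triples `⟨⟨f, g⟩, r⟩` with `r`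
the required shadow. Existence and uniqueness of `r` are proved for standard `f, g` and then
transferred. -/
theorem exists_isHull_dist (hm : IsMetric d) (hw : w ∈ I) (hB : st B) (hBmem : ∀ f, st f →
    (f ∈ B ↔ IsFun f I M ∧ ∃ x : El M, App f w x.1 ∧ IsFinitePoint d x)) :
    ∃ D : El B → El B → El R, StandardFun₂ D ∧
      ∀ f g : El B, st f.1 → st g.1 → ∀ x y : El M, App f.1 w x.1 → App g.1 w y.1 →
        IsShadow (D f g) (d x y) := by
  have : Fact (st B) := ⟨hB⟩
  obtain ⟨P, hP⟩ := exists_prod B B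
  obtain ⟨Q, hQ⟩ := exists_prod P R
  obtain ⟨G, hGst, hG⟩ := standardization (fun z => ∃ (f g : El B) (r : El R) (p : V),
    IsPair p f.1 g.1 ∧ IsPair z p r.1 ∧ ∀ x y : El M, App f.1 w x.1 → App g.1 w y.1 →
        IsShadow r (d x y)) Q
  let T : El B → El B → El R → Prop := fun f g r =>
    ∃ p z : V, IsPair p f.1 g.1 ∧ IsPair z p r.1 ∧ z ∈ G
  have hT : ∀ (f g : El B) (r : El R), st f.1 → st g.1 → st r.1 → (T f g r ↔
      ∀ x y : El M, App f.1 w x.1 → App g.1 w y.1 → IsShadow r (d x y)) := by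
    intro f g r hf hg hr
    obtain ⟨p, hp⟩ := exists_isPair f.1 g.1
    obtain ⟨z, hz⟩ := exists_isPair p r.1
    have hzst : st z := param_stSet.1 (hz.param (hp.param (param_stSet.2 hf) (param_stSet.2 hg))
      (param_stSet.2 hr))
    have hzQ : z ∈ Q := (hQ z).2 ⟨p, (hP p).2 ⟨f.1, f.2, g.1, g.2, hp⟩, r.1, r.2, hz⟩
    constructor
    · rintro ⟨p', z', hp', hz', hzG⟩
      obtain rfl := hp'.unique hp
      obtain rfl := hz'.unique hz
      obtain ⟨-, f', g', r', q, hq, hz', h⟩ := (hG _ hzst).1 hzG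
      obtain ⟨rfl, hr'⟩ := hz.inj hz'
      obtain ⟨hf', hg'⟩ := hp.inj hq
      rw [Subtype.ext hf', Subtype.ext hg', Subtype.ext hr']
      exact h
    · exact fun h => ⟨p, z, hp, hz, (hG z hzst).2 ⟨hzQ, f, g, r, p, hp, hz, h⟩⟩
  have hTu : ∀ f g : El B, ∃! r, T f g r := by
    refine transfer₂ (V := V) (p := fun f g : El B => ∃! r : El R,
      ∃ p z : V, IsPair p f.1 g.1 ∧ IsPair z p r.1 ∧ z ∈ G) fun f g hf hg => ?_
    have hf' := param_stSet_el.1 hf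
    have hg' := param_stSet_el.1 hg
    have : Fact (st f.1) := ⟨hf'⟩
    have : Fact (st g.1) := ⟨hg'⟩
    obtain ⟨hfF, x, hx, hxfin⟩ := (hBmem _ hf').1 f.2
    obtain ⟨hgF, y, hy, hyfin⟩ := (hBmem _ hg').1 g.2
    obtain ⟨r, hr⟩ := (hxfin.limited_dist hm hyfin).exists_shadow
    have : Fact (st r.1) := ⟨hr.1⟩
    refine ⟨r, (hT f g r hf' hg' hr.1).2 fun x' y' hx' hy' => ?_, ?_⟩
    · rwa [← Subtype.ext (hfF.app_unique hw hx hx'), ← Subtype.ext (hgF.app_unique hw hy hy')]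
    -- `hT` describes only standard `s`; with `f, g, r` standard, Transfer excludes nonstandard
    -- competitors too.
    · refine transfer (V := V) (p := fun s : El R =>
        (∃ p z : V, IsPair p f.1 g.1 ∧ IsPair z p s.1 ∧ z ∈ G) → s = r) fun s hs hsT => ?_
      exact ((hT f g s hf' hg' (param_stSet_el.1 hs)).1 hsT x y hx hy).unique hr
  choose D hD hDu using hTu
  refine ⟨D, ?_, fun f g hf hg => (hT f g _ hf hg ?_).1 (hD f g)⟩
  · have : DefFun memLang (stSet V) (fun q : El B × El B => D q.1 q.2) := .of_graph <|
      (inferInstance : DefPred memLang (stSet V) (fun q : (El B × El B) × V =>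
        ∃ r : El R, r.1 = q.2 ∧ ∃ p z : V, IsPair p q.1.1.1 q.1.2.1 ∧ IsPair z p r.1 ∧ z ∈ G)).congr
        fun q => by
          constructor
          · rintro ⟨r, hr, h⟩
            rw [← hr, hDu _ _ r h]
          · exact fun h => ⟨_, h.symm, hD _ _⟩
    exact standardFun₂_of_defFun
  · have : Fact (st f.1) := ⟨hf⟩
    have : Fact (st g.1) := ⟨hg⟩
    exact param_stSet_el.1 (param_of_unique (fun r : El R =>
      ∃ p z : V, IsPair p f.1 g.1 ∧ IsPair z p r.1 ∧ z ∈ G) (hD f g) (hDu f g))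

end Hull
set_option linter.unusedSectionVars false

/-! ### The pseudometric on `B` and its quotient -/

section Quotient

variable {V : Type u} [StMem V] {R : V} [Field (El R)] [LinearOrder (El R)]

/-- The standard objects from which the nonstandard hull is formed as a quotient. -/
structure IsHullBase (I w : V) {M : V} (d : El M → El M → El R) (B E : V)
    (D : El B → El B → El R) : Prop where
  st_B : st B
  mem_B : ∀ f, st f →
    (f ∈ B ↔ IsFun f I M ∧ ∃ x : El M, App f w x.1 ∧ IsFinitePoint d x)
  st_E : st E
  mem_E : ∀ z, st z → (z ∈ E ↔ ∃ f g, f ∈ B ∧ g ∈ B ∧ IsPair z f g ∧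
    ∃ x y : El M, App f w x.1 ∧ App g w y.1 ∧ InfClose (d x y) 0)
  st_D : StandardFun₂ D
  D_eq : ∀ f g : El B, st f.1 → st g.1 → ∀ x y : El M, App f.1 w x.1 → App g.1 w y.1 →
    IsShadow (D f g) (d x y)

theorem IsHull.isHullBase {I w M : V} {d : El M → El M → El R} {B E : V}
    {D : El B → El B → El R} {Mh : V} {Dh : El Mh → El Mh → El R}
    (h : IsHull I w d B E D Mh Dh) : IsHullBase I w d B E D :=
  ⟨h.st_B, h.mem_B, h.st_E, h.mem_E, h.st_D, h.D_eq⟩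

/-- `D` is a pseudometric on `B`, and `E` is the relation `D(f, g) = 0`. -/
structure IsPseudoMetricWith {B : V} (E : V) (D : El B → El B → El R) : Prop where
  nonneg : ∀ f g, 0 ≤ D f g
  self : ∀ f, D f f = 0
  symm : ∀ f g, D f g = D g f
  triangle : ∀ f g h, D f h ≤ D f g + D g h
  app_iff : ∀ f g : El B, App E f.1 g.1 ↔ D f g = 0
  subset : ∀ z, z ∈ E → ∃ f g, f ∈ B ∧ g ∈ B ∧ IsPair z f g

variable [IsStrictOrderedRing (El R)] [hV : Fact (ModelsBST V)] [hR : Fact (IsReals R)]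

section Base

variable {I w M : V} [hI : Fact (st I)] [hM : Fact (st M)] {d : El M → El M → El R} {B E : V}
  {D : El B → El B → El R}

theorem IsHullBase.isFun (h : IsHullBase I w d B E D) : ∀ f, f ∈ B → IsFun f I M := by
  have : Fact (st B) := ⟨h.st_B⟩
  exact transfer (V := V) fun f hf hfB => ((h.mem_B f (param_stSet.1 hf)).1 hfB).1

/-- Every clause is an `∈`-formula in the standard sets `B`, `E`, `D`. At standard arguments `D` is
a shadow of `d` at `w`, and the clauses reduce to the metric axioms through monotonicity, additivity
and uniqueness of shadows. -/
theorem IsHullBase.isPseudoMetricWith (h : IsHullBase I w d B E D) (hm : IsMetric d)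
    (hw : w ∈ I) : IsPseudoMetricWith E D := by
  have : Fact (st B) := ⟨h.st_B⟩
  have : Fact (st E) := ⟨h.st_E⟩
  have : Fact (StandardFun₂ D) := ⟨h.st_D⟩
  have hval : ∀ f : El B, ∃ x : El M, App f.1 w x.1 := fun f => (h.isFun f.1 f.2).exists_app hw
  refine ⟨transfer₂ (V := V) fun f g hf hg => ?_, transfer (V := V) fun f hf => ?_,
    transfer₂ (V := V) fun f g hf hg => ?_, transfer₃ (V := V) fun f g k hf hg hk => ?_,
    transfer₂ (V := V) fun f g hf hg => ?_, transfer (V := V) fun z hz hzE => ?_⟩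
  · obtain ⟨x, hx⟩ := hval f
    obtain ⟨y, hy⟩ := hval g
    exact (IsShadow.self (param_stSet.1 inferInstance)).le
      (h.D_eq f g (param_stSet_el.1 hf) (param_stSet_el.1 hg) x y hx hy) (hm.nonneg x y)
  · obtain ⟨x, hx⟩ := hval f
    have := h.D_eq f f (param_stSet_el.1 hf) (param_stSet_el.1 hf) x x hx hx
    rw [(hm.eq_zero_iff x x).2 rfl] at this
    exact this.unique (IsShadow.self (param_stSet.1 inferInstance))
  · obtain ⟨x, hx⟩ := hval f
    obtain ⟨y, hy⟩ := hval g
    have := h.D_eq f g (param_stSet_el.1 hf) (param_stSet_el.1 hg) x y hx hy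
    rw [hm.symm] at this
    exact this.unique (h.D_eq g f (param_stSet_el.1 hg) (param_stSet_el.1 hf) y x hy hx)
  · obtain ⟨x, hx⟩ := hval f
    obtain ⟨y, hy⟩ := hval g
    obtain ⟨z, hz⟩ := hval k
    exact (h.D_eq f k (param_stSet_el.1 hf) (param_stSet_el.1 hk) x z hx hz).le
      ((h.D_eq f g (param_stSet_el.1 hf) (param_stSet_el.1 hg) x y hx hy).add
        (h.D_eq g k (param_stSet_el.1 hg) (param_stSet_el.1 hk) y z hy hz)) (hm.triangle x y z)
  · obtain ⟨x, hx⟩ := hval f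
    obtain ⟨y, hy⟩ := hval g
    have hD := h.D_eq f g (param_stSet_el.1 hf) (param_stSet_el.1 hg) x y hx hy
    rw [hD.eq_zero_iff]
    constructor
    · rintro ⟨p, hpE, hp⟩
      have hpst := hp.param (param_stSet.2 (param_stSet_el.1 hf)) (param_stSet.2 (param_stSet_el.1 hg))
      obtain ⟨f', g', -, -, hp', x', y', hx', hy', hxy⟩ := (h.mem_E p (param_stSet.1 hpst)).1 hpE
      obtain ⟨rfl, rfl⟩ := hp.inj hp'
      rwa [Subtype.ext ((h.isFun f.1 f.2).app_unique hw hx hx'),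
        Subtype.ext ((h.isFun g.1 g.2).app_unique hw hy hy')]
    · intro hxy
      obtain ⟨p, hp⟩ := exists_isPair f.1 g.1
      have hpst := hp.param (param_stSet.2 (param_stSet_el.1 hf)) (param_stSet.2 (param_stSet_el.1 hg))
      exact ⟨p, (h.mem_E p (param_stSet.1 hpst)).2 ⟨f.1, g.1, f.2, g.2, hp, x, y, hx, hy, hxy⟩, hp⟩
  · obtain ⟨f, g, hf, hg, hp, -⟩ := (h.mem_E z (param_stSet.1 hz)).1 hzE
    exact ⟨f, g, hf, hg, hp⟩

end Base

section PseudoMetric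

variable {B E : V} {D : El B → El B → El R}

theorem IsPseudoMetricWith.app_mem (hD : IsPseudoMetricWith E D) {f g : V} (h : App E f g) :
    f ∈ B ∧ g ∈ B := by
  obtain ⟨p, hpE, hp⟩ := h
  obtain ⟨f', g', hf, hg, hp'⟩ := hD.subset p hpE
  obtain ⟨rfl, rfl⟩ := hp.inj hp'
  exact ⟨hf, hg⟩

theorem IsPseudoMetricWith.isEquivRel (hD : IsPseudoMetricWith E D) : IsEquivRel B E where
  subset := hD.subset
  refl f hf := (hD.app_iff ⟨f, hf⟩ ⟨f, hf⟩).2 (hD.self _)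
  symm f g h := by
    obtain ⟨hf, hg⟩ := hD.app_mem h
    have h' := (hD.app_iff ⟨f, hf⟩ ⟨g, hg⟩).1 h
    exact (hD.app_iff ⟨g, hg⟩ ⟨f, hf⟩).2 (by rw [hD.symm, h'])
  trans f g k h1 h2 := by
    obtain ⟨hf, hg⟩ := hD.app_mem h1
    obtain ⟨-, hk⟩ := hD.app_mem h2
    have h1 := (hD.app_iff ⟨f, hf⟩ ⟨g, hg⟩).1 h1
    have h2 := (hD.app_iff ⟨g, hg⟩ ⟨k, hk⟩).1 h2
    refine (hD.app_iff ⟨f, hf⟩ ⟨k, hk⟩).2 (le_antisymm ?_ (hD.nonneg _ _))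
    linarith [hD.triangle ⟨f, hf⟩ ⟨g, hg⟩ ⟨k, hk⟩]

theorem IsPseudoMetricWith.dist_congr (hD : IsPseudoMetricWith E D) {f f' g g' : El B}
    (hf : App E f.1 f'.1) (hg : App E g.1 g'.1) : D f g = D f' g' := by
  have hf := (hD.app_iff _ _).1 hf
  have hg := (hD.app_iff _ _).1 hg
  refine le_antisymm ?_ ?_ <;>
  linarith [hD.triangle f f' g, hD.triangle f' g' g, hD.triangle f' f g', hD.triangle f g g',
    hD.symm g g', hD.symm f f']

theorem IsPseudoMetricWith.isClass_congr (hD : IsPseudoMetricWith E D) {f g : El B} {c : V}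
    (hf : IsClass B E f.1 c) (hg : IsClass B E g.1 c) : App E f.1 g.1 :=
  ((hf g.1).1 ((hg g.1).2 ⟨g.2, hD.isEquivRel.refl _ g.2⟩)).2

theorem IsPseudoMetricWith.isClass_of_app (hD : IsPseudoMetricWith E D) {f g : El B} {c : V}
    (hf : IsClass B E f.1 c) (h : App E f.1 g.1) : IsClass B E g.1 c := fun k =>
  (hf k).trans (and_congr_right fun _ =>
    ⟨hD.isEquivRel.trans _ _ _ (hD.isEquivRel.symm _ _ h), hD.isEquivRel.trans _ _ _ h⟩)

theorem exists_isClass (B E f : V) : ∃ c, IsClass B E f c :=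
  separation (fun g => App E f g) B

/-- Representatives are picked in the metatheory, so `Dh` is at this stage only an external
function. Independence of the representatives later makes its graph definable, hence standard. -/
theorem exists_isHull_quotient (hD : IsPseudoMetricWith E D) :
    ∃ (Mh : V) (Dh : El Mh → El Mh → El R), (∀ c, c ∈ Mh ↔ ∃ f, f ∈ B ∧ IsClass B E f c) ∧
      ∀ f g : El B, ∀ a b : El Mh, IsClass B E f.1 a.1 → IsClass B E g.1 b.1 →
        Dh a b = D f g := by
  obtain ⟨P, hP⟩ := hV.out.powerset B
  obtain ⟨Mh, hMh⟩ := separation (fun c => ∃ f, f ∈ B ∧ IsClass B E f c) P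
  have hMh' : ∀ c, c ∈ Mh ↔ ∃ f, f ∈ B ∧ IsClass B E f c := fun c => (hMh c).trans
    ⟨And.right, fun h => ⟨(hP c).2 fun g hg => by
      obtain ⟨f, -, hc⟩ := h
      exact ((hc g).1 hg).1, h⟩⟩
  choose rep hrepB hrep using fun c : El Mh => (hMh' c.1).1 c.2
  refine ⟨Mh, fun a b => D ⟨rep a, hrepB a⟩ ⟨rep b, hrepB b⟩, hMh', fun f g a b ha hb => ?_⟩
  exact hD.dist_congr (hD.isClass_congr (hrep a) ha) (hD.isClass_congr (hrep b) hb)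

variable {Mh : V} {Dh : El Mh → El Mh → El R}

/-- The metric on the quotient of a pseudometric space. -/
structure IsQuotientMetric (B E : V) (D : El B → El B → El R) {Mh : V}
    (Dh : El Mh → El Mh → El R) : Prop where
  mem_Mh : ∀ c, c ∈ Mh ↔ ∃ f, f ∈ B ∧ IsClass B E f c
  Dh_eq : ∀ f g : El B, ∀ a b : El Mh, IsClass B E f.1 a.1 → IsClass B E g.1 b.1 →
    Dh a b = D f g

theorem IsQuotientMetric.exists_rep (h : IsQuotientMetric B E D Dh) (a : El Mh) :
    ∃ f : El B, IsClass B E f.1 a.1 := by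
  obtain ⟨f, hf, ha⟩ := (h.mem_Mh a.1).1 a.2
  exact ⟨⟨f, hf⟩, ha⟩

theorem IsQuotientMetric.exists_class (h : IsQuotientMetric B E D Dh) (f : El B) :
    ∃ a : El Mh, IsClass B E f.1 a.1 := by
  obtain ⟨c, hc⟩ := exists_isClass B E f.1
  exact ⟨⟨c, (h.mem_Mh c).2 ⟨f.1, f.2, hc⟩⟩, hc⟩

theorem IsQuotientMetric.isMetric (h : IsQuotientMetric B E D Dh)
    (hD : IsPseudoMetricWith E D) : IsMetric Dh where
  nonneg a b := by
    obtain ⟨f, hf⟩ := h.exists_rep a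
    obtain ⟨g, hg⟩ := h.exists_rep b
    rw [h.Dh_eq f g a b hf hg]
    exact hD.nonneg f g
  eq_zero_iff a b := by
    obtain ⟨f, hf⟩ := h.exists_rep a
    obtain ⟨g, hg⟩ := h.exists_rep b
    rw [h.Dh_eq f g a b hf hg, ← hD.app_iff]
    constructor
    · intro hfg
      have := hD.isClass_of_app hf hfg
      exact Subtype.ext (ext fun k => (this k).trans (hg k).symm)
    · rintro rfl
      exact hD.isClass_congr hf hg
  symm a b := by
    obtain ⟨f, hf⟩ := h.exists_rep a
    obtain ⟨g, hg⟩ := h.exists_rep b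
    rw [h.Dh_eq f g a b hf hg, h.Dh_eq g f b a hg hf, hD.symm]
  triangle a b c := by
    obtain ⟨f, hf⟩ := h.exists_rep a
    obtain ⟨g, hg⟩ := h.exists_rep b
    obtain ⟨k, hk⟩ := h.exists_rep c
    rw [h.Dh_eq f g a b hf hg, h.Dh_eq g k b c hg hk, h.Dh_eq f k a c hf hk]
    exact hD.triangle f g k

theorem IsQuotientMetric.standard (h : IsQuotientMetric B E D Dh) (hB : st B) (hE : st E)
    (hDst : StandardFun₂ D) : st Mh ∧ StandardFun₂ Dh := by
  have : Fact (st B) := ⟨hB⟩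
  have : Fact (st E) := ⟨hE⟩
  have : Fact (StandardFun₂ D) := ⟨hDst⟩
  have hMh : Param (stSet V) Mh :=
    param_of_mem_iff (fun c => ∃ f, f ∈ B ∧ IsClass B E f c) h.mem_Mh
  refine ⟨param_stSet.1 hMh, ?_⟩
  have : DefFun memLang (stSet V) (fun q : El Mh × El Mh => Dh q.1 q.2) := .of_graph <|
    (inferInstance : DefPred memLang (stSet V) (fun q : (El Mh × El Mh) × V =>
      ∃ f g : El B, IsClass B E f.1 q.1.1.1 ∧ IsClass B E g.1 q.1.2.1 ∧ q.2 = (D f g).1)).congr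
      fun q => by
        constructor
        · rintro ⟨f, g, hf, hg, hq⟩
          rw [h.Dh_eq f g _ _ hf hg, hq]
        · intro hq
          obtain ⟨f, hf⟩ := h.exists_rep q.1.1
          obtain ⟨g, hg⟩ := h.exists_rep q.1.2
          exact ⟨f, g, hf, hg, by rw [hq, h.Dh_eq f g _ _ hf hg]⟩
  exact standardFun₂_of_defFun

/-- A standard set of representatives. -/
theorem IsQuotientMetric.exists_transversal (h : IsQuotientMetric B E D Dh)
    (hD : IsPseudoMetricWith E D) (hMh : st Mh) :
    ∃ C : V, st C ∧ ∀ a : El Mh, ∃! f, f ∈ a.1 ∧ f ∈ C := by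
  have : Fact (st Mh) := ⟨hMh⟩
  -- The classes are nonempty and pairwise disjoint, so Choice gives a transversal; Transfer
  -- replaces it by a standard one.
  obtain ⟨C, hC, h'⟩ := transfer_exists (V := V) (p := fun C : V => ∀ a : El Mh, ∃! f : V, f ∈ a.1 ∧ f ∈ C)
    (by
      obtain ⟨C, hC⟩ := hV.out.choice Mh (fun c hc => by
        obtain ⟨f, hf⟩ := h.exists_rep ⟨c, hc⟩
        exact ⟨f.1, (hf _).2 ⟨f.2, hD.isEquivRel.refl _ f.2⟩⟩) (by
        rintro x y hx hy ⟨k, hkx, hky⟩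
        obtain ⟨f, hf⟩ := h.exists_rep ⟨x, hx⟩
        obtain ⟨g, hg⟩ := h.exists_rep ⟨y, hy⟩
        have h1 := (hf k).1 hkx
        have h2 := (hg k).1 hky
        have := hD.isClass_of_app hf (hD.isEquivRel.trans _ _ _ h1.2 (hD.isEquivRel.symm _ _ h2.2))
        exact ext fun z => (this z).trans (hg z).symm)
      exact ⟨C, fun a => hC a.1 a.2⟩)
  exact ⟨C, param_stSet.1 hC, h'⟩

end PseudoMetric

end Quotient

set_option linter.unusedSectionVars false

/-! ### Completeness of the hull -/

section Completeness

variable {V : Type u} [StMem V] [hV : Fact (ModelsBST V)]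

theorem exists_standard_fun {I M : V} [Fact (st I)] [Fact (st M)] (Q : El I → El M → Prop)
    [DefPred memLang (stSet V) (fun q : El I × El M => Q q.1 q.2)] (hQ : ∀ i, ∃! y, Q i y) :
    ∃ f : V, st f ∧ IsFun f I M ∧ ∀ (i : El I) (y : El M), App f i.1 y.1 ↔ Q i y := by
  obtain ⟨f, hf, h⟩ := standardRel_of_defPred (r := Q)
  have hApp : ∀ (i : El I) (y : V), App f i.1 y ↔ ∃ y' : El M, y'.1 = y ∧ Q i y' := fun i y => by
    constructor
    · rintro ⟨p, hpf, hp⟩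
      obtain ⟨a, b, hab, hp'⟩ := (h p).1 hpf
      obtain ⟨h1, h2⟩ := hp.inj hp'
      obtain rfl := Subtype.ext h1
      exact ⟨b, h2.symm, hab⟩
    · rintro ⟨y', rfl, hy⟩
      obtain ⟨p, hp⟩ := exists_isPair i.1 y'.1
      exact ⟨p, (h p).2 ⟨i, y', hy, hp⟩, hp⟩
  refine ⟨f, hf, ⟨⟨fun p hp => ?_, fun i hi => ?_⟩, fun i y hiy => ?_⟩, fun i y => ?_⟩
  · obtain ⟨a, b, -, hp'⟩ := (h p).1 hp
    exact ⟨a.1, b.1, a.2, hp'⟩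
  · obtain ⟨y, hy, hyu⟩ := hQ ⟨i, hi⟩
    refine ⟨y.1, (hApp ⟨i, hi⟩ y.1).2 ⟨y, rfl, hy⟩, fun z hz => ?_⟩
    obtain ⟨y', rfl, hy'⟩ := (hApp ⟨i, hi⟩ z).1 hz
    rw [hyu y' hy']
  · obtain ⟨p, hpf, hp⟩ := hiy
    obtain ⟨a, b, -, hp'⟩ := (h p).1 hpf
    rw [(hp.inj hp').2]
    exact b.2
  · rw [hApp]
    constructor
    · rintro ⟨y', h', hy⟩
      rwa [← Subtype.ext h']
    · exact fun hy => ⟨y, rfl, hy⟩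

variable {R : V} [Field (El R)] [LinearOrder (El R)] [IsStrictOrderedRing (El R)]
  [hR : Fact (IsReals R)] {N : V} [Fact (st N)] {r : El N → El R}

/-- Overspill carried out uniformly in `i`: the index `m` is a definable function of `i`, with
`h(i)` as the bound on the search, so that the diagonal `f` is standard although its index at `w` is
not. -/
theorem exists_standard_diagonal (hrv : ∀ n, (r n).1 = n.1) (hrnat : ∀ n, IsNat (r n))
    (hrs : ∀ x : El R, IsNat x → ∃ n, r n = x)
    {I M : V} [Fact (st I)] [Fact (st M)] {d : El M → El M → El R} [Fact (StandardFun₂ d)]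
    (x : El N → El I → El M) [Fact (StandardFun₂ x)] (c : El N → El N → El R)
    [Fact (StandardFun₂ c)] (w : El I) (hw : Good N I w.1)
    (hxc : ∀ p q : El N, st p.1 → st q.1 → ∀ e : El R, st e.1 → 0 < e →
      d (x p w) (x q w) < c p q + e) :
    ∃ f : V, st f ∧ IsFun f I M ∧ ∃ m : El N, ¬ st m.1 ∧ App f w.1 (x m w).1 ∧
      ∀ p, r p ≤ r m → d (x p w) (x m w) * r m ≤ c p m * r m + 1 := by
  have hrinj : ∀ {m n : El N}, r m = r n → m = n := fun h =>
    Subtype.ext (by rw [← hrv, ← hrv, h])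
  have hrdef : ∀ {Γ : Type u} [Coded V Γ] {A : Set V} {t : Γ → El N} [DefFun memLang A t],
      DefFun memLang A (fun γ => r (t γ)) := fun {Γ _ A t _} => by
    refine .codRestrict ?_
    simp only [hrv]
    infer_instance
  obtain ⟨ν, hνN, ⟨h, hst, hfun, happ⟩, hν⟩ := hw
  have : Fact (st h) := ⟨hst⟩
  -- This is `d ≤ c + 1/m` with the denominator cleared. It is trivial for `m = 0`, so a maximal `m`
  -- below any bound exists.
  let P : El I → El N → Prop := fun i m =>
    ∀ p, r p ≤ r m → d (x p i) (x m i) * r m ≤ c p m * r m + 1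
  have hPdef : DefPred memLang (stSet V) (fun q : El I × El N => P q.1 q.2) := inferInstance
  obtain ⟨z, hz⟩ := hrs 0 isNat_zero
  have hmax : ∀ (i : El I) (n : El N), ∃ m, r m ≤ r n ∧ P i m ∧
      ∀ k, r k ≤ r n → P i k → r k ≤ r m := by
    intro i n
    have hPdef' := hPdef.mono (Set.subset_univ _)
    have : DefPred memLang (Set.univ : Set V)
        (fun q : (PUnit.{u + 1} × El R) × El N => P i q.2) := hPdef'.comp₂ (r := P)
    obtain ⟨m, hm, hmn, ⟨m', rfl, hP⟩, hmm⟩ := IsNat.exists_max (n := r n)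
      (fun y : El R => ∃ k : El N, r k = y ∧ P i k) ⟨z, hz, fun p _ => by simp [hz]⟩ (hrnat n)
    exact ⟨m', hmn, hP, fun k hk hPk => hmm _ (hrnat k) hk ⟨k, rfl, hPk⟩⟩
  have hmaxu : ∀ {i : El I} {n m m' : El N}, (r m ≤ r n ∧ P i m ∧
      ∀ k, r k ≤ r n → P i k → r k ≤ r m) → (r m' ≤ r n ∧ P i m' ∧
      ∀ k, r k ≤ r n → P i k → r k ≤ r m') → m = m' := fun h h' =>
    hrinj (le_antisymm (h'.2.2 _ h.1 h.2.1) (h.2.2 _ h'.1 h'.2.1))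
  have hu : ∀ {i : El I} {n n' : El N}, App h i.1 n.1 → App h i.1 n'.1 → n = n' :=
    fun {i _ _} h1 h2 => Subtype.ext ((hfun.2 i.1 i.2).unique h1 h2)
  have : DefPred memLang (stSet V)
      (fun q : ((El I × El M) × El N) × El N => P q.1.1.1 q.1.2) := hPdef.comp₂ (r := P)
  have : DefPred memLang (stSet V)
      (fun q : (((El I × El M) × El N) × El N) × El N => P q.1.1.1.1 q.2) :=
    hPdef.comp₂ (r := P)
  -- `h` need not take values in `N` everywhere; where it does not, the index defaults to `0`.
  obtain ⟨f, hf, hfF, hfapp⟩ := exists_standard_fun (fun (i : El I) (y : El M) => ∃ m : El N, y = x m i ∧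
      ((∃ n : El N, App h i.1 n.1 ∧ r m ≤ r n ∧ P i m ∧ ∀ k, r k ≤ r n → P i k → r k ≤ r m) ∨
        ((¬ ∃ n : El N, App h i.1 n.1) ∧ r m = 0))) fun i => by
    by_cases hi : ∃ n : El N, App h i.1 n.1
    · obtain ⟨n, hn⟩ := hi
      obtain ⟨m, hm⟩ := hmax i n
      refine ⟨x m i, ⟨m, rfl, Or.inl ⟨n, hn, hm⟩⟩, ?_⟩
      rintro _ ⟨m', rfl, ⟨n', hn', hm'⟩ | ⟨hno, -⟩⟩
      · obtain rfl := hu hn hn'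
        rw [hmaxu hm hm']
      · exact absurd ⟨n, hn⟩ hno
    · refine ⟨x z i, ⟨z, rfl, Or.inr ⟨hi, hz⟩⟩, ?_⟩
      rintro _ ⟨m', rfl, ⟨n', hn', -⟩ | ⟨-, hm'⟩⟩
      · exact absurd ⟨n', hn'⟩ hi
      · rw [hrinj (hm'.trans hz.symm)]
  obtain ⟨m, hmn, hPm, hmm⟩ := hmax w ⟨ν, hνN⟩
  refine ⟨f, hf, hfF, m, fun hmst => ?_, (hfapp w _).2 ⟨m, rfl, Or.inl ⟨⟨ν, hνN⟩, happ, hmn, hPm,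
    hmm⟩⟩, hPm⟩
  have hrst : ∀ {k : El N}, st k.1 → st (r k).1 := fun {k} hk => by rwa [hrv]
  -- All `p ≤ k` are standard, so `hxc` applies with `e = 1/k`.
  have hPst : ∀ k : El N, st k.1 → P w k := by
    intro k hk p hpk
    have hp : st p.1 := by
      rw [← hrv]
      exact (hrnat k).st_of_le (hrst hk) (hrnat p) hpk
    rcases (hrnat k).nonneg.eq_or_lt with h0 | h0
    · simp [← h0]
    · have := hxc p k hp hk (1 / r k) (param_stSet_el.1 (param_apply₂ inferInstance
        (param_stSet_el.2 (hrst hk)))) (one_div_pos.2 h0)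
      have := mul_le_mul_of_nonneg_right this.le h0.le
      rwa [add_mul, one_div_mul_cancel h0.ne'] at this
  -- Were `m` standard, `m + 1` would be standard, hence below `ν` and admissible, against the
  -- maximality of `m`.
  obtain ⟨m', hm'⟩ := hrs _ (hrnat m).succ
  have hm'st : st m'.1 := by
    rw [← hrv, hm']
    exact param_stSet_el.1 (param_apply₂ (param_stSet_el.2 (hrst hmst)) inferInstance)
  have hm'ν : r m' < r ⟨ν, hνN⟩ := (hrnat _).lt_of_not_st (by rwa [hrv]) (hrnat _) (hrst hm'st)
  have := hmm m' hm'ν.le (hPst m' hm'st)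
  linarith

end Completeness
set_option linter.unusedSectionVars false

/-! ### Limits of Cauchy sequences and the assembly of the hull -/

section Completeness

variable {V : Type u} [StMem V] [hV : Fact (ModelsBST V)]
  {R : V} [Field (El R)] [LinearOrder (El R)] [IsStrictOrderedRing (El R)]
  [hR : Fact (IsReals R)] {N : V}

theorem IsHullBase.exists_limit (hN : IsNaturals R N) {I w M : V} [Fact (st I)] [Fact (st M)]
    {d : El M → El M → El R} [Fact (StandardFun₂ d)] (hm : IsMetric d) (hwI : w ∈ I)
    (hw : Good N I w) {B E : V} {D : El B → El B → El R} (h : IsHullBase I w d B E D)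
    (hD : IsPseudoMetricWith E D) {Mh : V} {Dh : El Mh → El Mh → El R}
    (hq : IsQuotientMetric B E D Dh) :
    ∀ F : V, IsFun F N Mh → IsCauchy Dh F → ∃ a, ConvergesTo Dh F a := by
  have : Fact (st N) := ⟨param_stSet.1 hN.param⟩
  have : Fact (st B) := ⟨h.st_B⟩
  have : Fact (st E) := ⟨h.st_E⟩
  have : Fact (StandardFun₂ D) := ⟨h.st_D⟩
  obtain ⟨hMh, hDh⟩ := hq.standard h.st_B h.st_E h.st_D
  have : Fact (st Mh) := ⟨hMh⟩
  have : Fact (StandardFun₂ Dh) := ⟨hDh⟩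
  obtain ⟨C, hCst, hC⟩ := hq.exists_transversal hD hMh
  have : Fact (st C) := ⟨hCst⟩
  choose r hrv hrnat using fun n : El N => (hN n.1).1 n.2
  have hrs : ∀ x : El R, IsNat x → ∃ n, r n = x := fun x hx =>
    ⟨⟨x.1, (hN _).2 ⟨x, rfl, hx⟩⟩, Subtype.ext (hrv _)⟩
  have hrdef : ∀ {Γ : Type u} [Coded V Γ] {A : Set V} {t : Γ → El N} [DefFun memLang A t],
      DefFun memLang A (fun γ => r (t γ)) := fun {Γ _ A t _} => by
    refine .codRestrict ?_
    simp only [hrv]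
    infer_instance
  refine transfer (V := V) (p := fun F : V => IsFun F N Mh → IsCauchy Dh F → ∃ a, ConvergesTo Dh F a)
    (hp := by unfold IsCauchy ConvergesTo; infer_instance) fun F hFst hF hFC => ?_
  have : Fact (st F) := ⟨param_stSet.1 hFst⟩
  -- The representative of `F(n)` lying in `C` is unique; this makes `n ↦ G n` definable from
  -- standard sets.
  have hG : ∀ n : El N, ∃ g : El B, ∀ g', (∃ c : V, App F n.1 c ∧ g'.1 ∈ c ∧ g'.1 ∈ C) ↔ g' = g := by
    intro n
    obtain ⟨a, ha⟩ := hF.exists_app n.2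
    obtain ⟨k, ⟨hka, hkC⟩, hku⟩ := hC a
    obtain ⟨f, hf⟩ := hq.exists_rep a
    refine ⟨⟨k, ((hf k).1 hka).1⟩, fun g' => ⟨?_, ?_⟩⟩
    · rintro ⟨c, hc, hgc, hgC⟩
      obtain rfl := hF.app_unique n.2 ha hc
      exact Subtype.ext (hku _ ⟨hgc, hgC⟩)
    · rintro rfl
      exact ⟨a.1, ha, hka, hkC⟩
  choose G hG using hG
  have hGclass : ∀ (n : El N) (a : El Mh), App F n.1 a.1 → IsClass B E (G n).1 a.1 := by
    intro n a ha
    obtain ⟨c, hc, hgc, -⟩ := (hG n _).2 rfl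
    obtain rfl := hF.app_unique n.2 ha hc
    obtain ⟨f, hf⟩ := hq.exists_rep a
    exact hD.isClass_of_app hf ((hf _).1 hgc).2
  have hGdef : ∀ {Γ : Type u} [Coded V Γ] {t : Γ → El N} [DefFun memLang (stSet V) t],
      DefFun memLang (stSet V) (fun γ => G (t γ)) := fun {Γ _ t ht} => by
    refine DefFun.comp (t := G) (.of_graph ?_) ht
    refine (inferInstance : DefPred memLang (stSet V) (fun q : El N × V =>
      ∃ g' : El B, g'.1 = q.2 ∧ ∃ c : V, App F q.1.1 c ∧ g'.1 ∈ c ∧ g'.1 ∈ C)).congr fun q => ?_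
    simp only [hG, exists_eq_right]
    exact eq_comm
  have hGst : ∀ n : El N, st n.1 → st (G n).1 := fun n hn => by
    have : Fact (st n.1) := ⟨hn⟩
    exact param_stSet_el.1 (param_of_unique (fun g => g = G n) rfl fun _ h => h)
  have hx : ∀ (n : El N) (i : El I), ∃ y : El M, ∀ y' : El M, App (G n).1 i.1 y'.1 ↔ y' = y := by
    intro n i
    have hGF := h.isFun _ (G n).2
    obtain ⟨y, hy⟩ := hGF.exists_app i.2
    refine ⟨y, fun y' => ⟨fun h' => Subtype.ext (hGF.app_unique i.2 h' hy), ?_⟩⟩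
    rintro rfl
    exact hy
  choose x hx using hx
  have hxst : StandardFun₂ x := by
    have : DefFun memLang (stSet V) (fun q : El N × El I => x q.1 q.2) := by
      refine .of_graph ?_
      refine (inferInstance : DefPred memLang (stSet V) (fun q : (El N × El I) × V =>
        ∃ y : El M, y.1 = q.2 ∧ App (G q.1.1).1 q.1.2.1 y.1)).congr fun q => ?_
      simp only [hx, exists_eq_right]
      exact eq_comm
    exact standardFun₂_of_defFun
  have : Fact (StandardFun₂ x) := ⟨hxst⟩
  have hcst : StandardFun₂ (fun p q => D (G p) (G q)) := by
    have : DefFun memLang (stSet V) (fun q : El N × El N => D (G q.1) (G q.2)) := inferInstance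
    exact standardFun₂_of_defFun (F := fun p q => D (G p) (G q))
  have : Fact (StandardFun₂ fun p q => D (G p) (G q)) := ⟨hcst⟩
  obtain ⟨f, hfst, hfF, m, hmst, hfm, hmd⟩ := exists_standard_diagonal hrv hrnat hrs x
    (fun p q => D (G p) (G q)) ⟨w, hwI⟩ hw fun p q hp hq' e he he0 =>
      (h.D_eq (G p) (G q) (hGst p hp) (hGst q hq') _ _ ((hx p ⟨w, hwI⟩ _).2 rfl)
        ((hx q ⟨w, hwI⟩ _).2 rfl)).lt_add' he he0
  have hmgt : ∀ n : El R, IsNat n → st n.1 → n < r m := fun n hn hnst =>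
    (hrnat m).lt_of_not_st (by rwa [hrv]) hn hnst
  -- For standard `ε` the modulus `k` can be taken standard, while `p` and `q` still range over all
  -- indices, including the nonstandard `m`.
  have hCauchy : ∀ ε : El R, st ε.1 → 0 < ε → ∃ k : El N, st k.1 ∧ ∀ p q : El N, r k ≤ r p →
      r k ≤ r q → D (G p) (G q) < ε := by
    intro ε hε hε0
    have : Fact (st ε.1) := ⟨hε⟩
    obtain ⟨k, hk, hk'⟩ := transfer_exists (V := V) (p := fun k : El N => ∀ p q : El N, r k ≤ r p →
      r k ≤ r q → D (G p) (G q) < ε) <| by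
        obtain ⟨k, hk, hk'⟩ := hFC ε hε0
        obtain ⟨k, rfl⟩ := hrs k hk
        refine ⟨k, fun p q hp hq' => ?_⟩
        obtain ⟨a, ha⟩ := hF.exists_app p.2
        obtain ⟨b, hb⟩ := hF.exists_app q.2
        rw [← hq.Dh_eq _ _ a b (hGclass p a ha) (hGclass q b hb)]
        exact hk' (r p) (r q) (hrnat p) (hrnat q) hp hq' a b (by rwa [hrv]) (by rwa [hrv])
    exact ⟨k, param_stSet_el.1 hk, hk'⟩
  -- As `m` exceeds every standard natural, both terms of the bound `D (G p) (G m) + 1/m` are below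
  -- `ε / 2`.
  have hclose : ∀ ε : El R, st ε.1 → 0 < ε → ∃ k : El N, st k.1 ∧ ∀ p : El N, r k ≤ r p →
      st p.1 → d (x p ⟨w, hwI⟩) (x m ⟨w, hwI⟩) < ε := by
    intro ε hε hε0
    obtain ⟨k, hk, hk'⟩ := hCauchy (ε / 2) (st_half hε) (half_pos hε0)
    refine ⟨k, hk, fun p hp hpst => ?_⟩
    obtain ⟨n, hn, hnst, hεn⟩ := exists_st_isNat_gt (x := 1 / (ε / 2)) <| param_stSet_el.1 <|
      param_apply₂ inferInstance (param_stSet_el.2 (st_half hε))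
    have hnm := hmgt n hn hnst
    have hm0 : 0 < r m := hn.nonneg.trans_lt hnm
    have h1 : 1 < ε / 2 * r m := by
      rw [div_lt_iff₀ (half_pos hε0)] at hεn
      have := mul_lt_mul_of_pos_right hnm (half_pos hε0)
      linarith
    have h2 := hmd p (hmgt _ (hrnat p) (by rwa [hrv])).le
    have h3 := hk' p m hp (hmgt _ (hrnat k) (by rwa [hrv])).le
    have h4 := mul_lt_mul_of_pos_right h3 hm0
    refine lt_of_mul_lt_mul_right (a := r m) ?_ hm0.le
    linarith
  -- `f(w)` is within distance `1` of the finite point `G_k(w)` for a suitable standard `k`.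
  have hfB : f ∈ B := by
    refine (h.mem_B f hfst).2 ⟨hfF, _, hfm, ?_⟩
    have h1 : st (1 : El R).1 := param_stSet.1 inferInstance
    obtain ⟨k, hk, hk'⟩ := hclose 1 h1 one_pos
    obtain ⟨-, y, hy, hyfin⟩ := (h.mem_B _ (hGst k hk)).1 (G k).2
    obtain rfl := (hx k ⟨w, hwI⟩ y).1 hy
    refine hyfin.of_limited_dist hm (limited_of_le h1 ?_)
    rw [hm.symm, abs_of_nonneg (hm.nonneg _ _)]
    exact (hk' k le_rfl hk).le
  obtain ⟨a, ha⟩ := hq.exists_class ⟨f, hfB⟩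
  have : Fact (st f) := ⟨hfst⟩
  have hast : Param (stSet V) a.1 := param_of_unique (fun c => IsClass B E f c) ha
    fun c hc => ext fun z => (hc z).trans (ha z).symm
  have : Fact (st a.1) := ⟨param_stSet.1 hast⟩
  -- `F` and the class `a` are standard, so convergence needs checking only for standard `ε` and,
  -- once `k` is standard, for standard `n`; there `D` is a shadow and `hclose` applies.
  refine ⟨a, transfer (V := V) (p := fun ε : El R => 0 < ε → ∃ k : El R, IsNat k ∧ ∀ n : El R,
    IsNat n → k ≤ n → ∀ x : El Mh, App F n.1 x.1 → Dh x a < ε) fun ε hε hε0 => ?_⟩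
  have hε' := param_stSet_el.1 hε
  have : Fact (st ε.1) := ⟨hε'⟩
  obtain ⟨k, hk, hk'⟩ := hclose (ε / 2) (st_half hε') (half_pos hε0)
  have : Fact (st (r k).1) := ⟨by rwa [hrv]⟩
  refine ⟨r k, hrnat k, transfer (V := V) (p := fun n : El R =>
    IsNat n → r k ≤ n → ∀ x : El Mh, App F n.1 x.1 → Dh x a < ε) fun n hn hnN hkn b hb => ?_⟩
  obtain ⟨n, rfl⟩ := hrs n hnN
  have hnst : st n.1 := by rw [← hrv]; exact param_stSet_el.1 hn
  rw [hrv] at hb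
  rw [hq.Dh_eq (G n) ⟨f, hfB⟩ b a (hGclass n b hb) ha]
  have := (h.D_eq (G n) ⟨f, hfB⟩ (hGst n hnst) hfst _ _
    ((hx n ⟨w, hwI⟩ _).2 rfl) hfm).lt_add
    (st_half hε') (half_pos hε0)
  linarith [hk' n hkn hnst]

theorem hullIsComplete (hN : IsNaturals R N) {I w M : V} [Fact (st I)] [Fact (st M)]
    {d : El M → El M → El R} [Fact (StandardFun₂ d)] (hm : IsMetric d) (hwI : w ∈ I)
    (hw : Good N I w) : HullIsComplete N I w d := by
  constructor
  · obtain ⟨B, hB, hBmem⟩ := exists_isHull_base d I w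
    obtain ⟨E, hE, hEmem⟩ := exists_isHull_rel d w B
    obtain ⟨D, hD, hDeq⟩ := exists_isHull_dist hm hwI hB hBmem
    have h : IsHullBase I w d B E D := ⟨hB, hBmem, hE, hEmem, hD, hDeq⟩
    obtain ⟨Mh, Dh, hMh, hDh⟩ := exists_isHull_quotient (h.isPseudoMetricWith hm hwI)
    exact ⟨B, E, D, Mh, Dh, hB, hBmem, hE, hEmem, hD, hDeq, hMh, hDh⟩
  · intro B E D Mh Dh hull
    have h := hull.isHullBase
    have hD := h.isPseudoMetricWith hm hwI
    have hq : IsQuotientMetric B E D Dh := ⟨hull.mem_Mh, hull.Dh_eq⟩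
    obtain ⟨h1, h2⟩ := hq.standard h.st_B h.st_E h.st_D
    exact ⟨hD.isEquivRel, h1, h2, hq.isMetric hD, h.exists_limit hN hm hwI hw hD hq⟩

/-- The standard function is the identity on `N`; `w` is nonstandard because every standard real is
limited. -/
theorem IsNat.good (hN : IsNaturals R N) {w : El R} (hw : IsNat w) (hlim : ¬ Limited w) :
    Good N N w.1 := by
  have : Fact (st N) := ⟨param_stSet.1 hN.param⟩
  have hwN : w.1 ∈ N := (hN _).2 ⟨w, rfl, hw⟩
  obtain ⟨f, hf, hfF, hfapp⟩ := exists_standard_fun (fun i y : El N => y = i) fun i =>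
    ⟨i, rfl, fun _ h => h⟩
  refine ⟨w.1, hwN, ⟨f, hf, hfF.1, (hfapp ⟨w.1, hwN⟩ ⟨w.1, hwN⟩).2 rfl⟩, fun hst => hlim ?_⟩
  exact limited_of_le hst (abs_of_nonneg hw.nonneg).le

end Completeness

end BST

/-- In every model `V` of `BST`: for a standard metric space `(M, d)`, the nonstandard hull
determined by an unlimited `w ∈ ℕ`, and more generally by a good element `w` of an infinite standard
set `I`, exists as a standard set with a standard metric, and is a complete metric space. -/
theorem mainTheorem1 {V : Type u} [BST.StMem V] (hV : BST.ModelsBST V)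
    (R : V) [Field (BST.El R)] [LinearOrder (BST.El R)] [IsStrictOrderedRing (BST.El R)]
    (hR : BST.IsReals R) (N : V) (hN : BST.IsNaturals R N)
    (M : V) (hM : BST.st M) (d : BST.El M → BST.El M → BST.El R)
    (hd : BST.StandardFun₂ d) (hmetric : BST.IsMetric d) :
    (∀ w : BST.El R, BST.IsNat w → ¬ BST.Limited w → BST.HullIsComplete N N w.1 d) ∧
    (∀ I w : V, BST.st I → ¬ BST.IsFin I → w ∈ I → BST.Good N I w →
      BST.HullIsComplete N I w d) := by
  have : Fact (BST.ModelsBST V) := ⟨hV⟩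
  have : Fact (BST.IsReals R) := ⟨hR⟩
  have : Fact (BST.st M) := ⟨hM⟩
  have : Fact (BST.StandardFun₂ d) := ⟨hd⟩
  refine ⟨fun w hw hlim => ?_, fun I w hI _ hwI hw => ?_⟩
  · have : Fact (BST.st N) := ⟨BST.param_stSet.1 hN.param⟩
    exact BST.hullIsComplete hN hmetric ((hN _).2 ⟨w, rfl, hw⟩) (hw.good hN hlim)
  · have : Fact (BST.st I) := ⟨hI⟩
    exact BST.hullIsComplete hN hmetric hwI hw
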